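/- Let $\mathfrak g$ be a finite-dimensional semisimple complex Lie algebra with Cartan subalgebra $\mathfrak h$, and let $\mathfrak p\supseteq\mathfrak h$ be a parabolic subalgebra, i.e. a subalgebra containing a Borel subalgebra $\mathfrak b\supseteq\mathfrak h$. Let $\mathfrak n$ be the nilradical of $\mathfrak p$, that is, the sum of the root spaces $\mathfrak g^{\alpha}\subseteq\mathfrak p$ with $\mathfrak g^{-\alpha}\not\subseteq\mathfrak p$; put $n=\dim\mathfrak n$, and let $\mathfrak n_-$ be the subalgebra generated by the opposite root spaces $\mathfrak g^{-\alpha}$. Let $u_1,\dots,u_n$ be a basis of $\mathfrak n_-$ consisting of root vectors, in any order. Let $V$ be an arbitrary $\mathfrak p$-module (not necessarily finite-dimensional); for example $V=V_\lambda(\mathfrak l)$, the irreducible finite-dimensional module of highest weight $\lambda$ over the Levi part $\mathfrak l\supseteq \mathfrak h$ of $\mathfrak p$, on which $\mathfrak n$ acts by zero. Let $$M(\mathfrak g,\mathfrak p,V)=U(\mathfrak g)\otimes_{U(\mathfrak p)}V$$ be the induced module (for $V=V_\lambda(\mathfrak l)$, the generalized Verma module $M_\lambda(\mathfrak g,\mathfrak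 p)$). Let $\mathbb S_n=\mathbb C[x_1,\dots,x_n]$, and let $\mathbb W_n$ be the Weyl algebra over $\mathbb C$ with generators $x_1,\dots,x_n,\partial_1,\dots,\partial_n$ and relations $x_ix_j=x_jx_i$, $\partial_i\partial_j=\partial_j\partial_i$, $\partial_jx_i-x_i\partial_j=\delta_{ij}$, acting on $\mathbb S_n$ by differential operators. Let $\mathbb W_n\otimes\operatorname{End}V$ act on $\mathbb S_n\otimes V$ by $(a\otimes b)\cdot(p\otimes v)=(a\cdot p)\otimes(b\, v)$. Then there is a linear isomorphism $\varphi: M(\mathfrak g,\mathfrak p,V)\to\mathbb S_n\otimes V$ with $$\varphi\left(u_1^{a_1}\cdots u_n^{a_n}\otimes_{U(\mathfrak p)} v\right)=x_1^{a_1}\cdots x_n^{a_n}\otimes v\qquad(a_1,\dots,a_n\in\mathbb Z_{\ge 0},\ v\in V),$$ and there is a homomorphism of unital associative algebras (hence of Lie algebras for the commutator brackets) $\Phi:U(\mathfrak g)\to\mathbb W_n\otimes\operatorname{End}V$ such that, for every $X\in U(\mathfrak g)$, the endomorphism $\varphi\circ(X\,\cdot)\circ\varphi^{-1}$ of $\mathbb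 S_n\otimes V$ is the action of $\Phi(X)$. In particular $\Phi$ restricts to a Lie algebra homomorphism $\mathfrak g\to\mathbb W_n\otimes\operatorname{End}V$. If moreover $\mathfrak g$ is simple, $\mathfrak p\neq\mathfrak g$ and $V\neq0$, this restriction is injective. -/

import Mathlib

open scoped TensorProduct

noncomputable section

/-! ### The Weyl algebra and its action on polynomials -/

section Weyl

/-- The defining relations of the Weyl algebra on the free algebra with generators
`x i` (`Sum.inl i`) and `∂ i` (`Sum.inr i`). -/
inductive WeylRel (R : Type*) [CommRing R] (σ : Type*) :
    FreeAlgebra R (σ ⊕ σ) → FreeAlgebra R (σ ⊕ σ) → Prop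
  | x_comm (i j : σ) : WeylRel R σ
      (FreeAlgebra.ι R (Sum.inl i) * FreeAlgebra.ι R (Sum.inl j))
      (FreeAlgebra.ι R (Sum.inl j) * FreeAlgebra.ι R (Sum.inl i))
  | d_comm (i j : σ) : WeylRel R σ
      (FreeAlgebra.ι R (Sum.inr i) * FreeAlgebra.ι R (Sum.inr j))
      (FreeAlgebra.ι R (Sum.inr j) * FreeAlgebra.ι R (Sum.inr i))
  | d_x_same (i : σ) : WeylRel R σ
      (FreeAlgebra.ι R (Sum.inr i) * FreeAlgebra.ι R (Sum.inl i)
        - FreeAlgebra.ι R (Sum.inl i) * FreeAlgebra.ι R (Sum.inr i)) 1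
  | d_x_ne (i j : σ) (h : j ≠ i) : WeylRel R σ
      (FreeAlgebra.ι R (Sum.inr j) * FreeAlgebra.ι R (Sum.inl i)
        - FreeAlgebra.ι R (Sum.inl i) * FreeAlgebra.ι R (Sum.inr j)) 0

/-- The Weyl algebra over `R` in the variables `σ`, by generators and relations. -/
abbrev WeylAlgebra (R : Type*) [CommRing R] (σ : Type*) : Type _ :=
  RingQuot (WeylRel R σ)

/-- The operators on polynomials by which the generators of the Weyl algebra act:
`x i` multiplies by the variable `X i`, and `∂ i` is the `i`-th partial derivative. -/
def weylGenAction (R : Type*) [CommRing R] (σ : Type*) :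
    σ ⊕ σ → Module.End R (MvPolynomial σ R) :=
  Sum.elim (fun i => LinearMap.mulLeft R (MvPolynomial.X i))
    (fun i => ((MvPolynomial.pderiv i :
      Derivation R (MvPolynomial σ R) (MvPolynomial σ R)) :
        MvPolynomial σ R →ₗ[R] MvPolynomial σ R))

/-- The action of the Weyl algebra on polynomials by differential operators. -/
def weylAction (R : Type*) [CommRing R] (σ : Type*) :
    WeylAlgebra R σ →ₐ[R] Module.End R (MvPolynomial σ R) :=
  RingQuot.liftAlgHom R ⟨FreeAlgebra.lift R (weylGenAction R σ), by
    classical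
    intro a b h
    induction h with
    | x_comm i j =>
      refine LinearMap.ext fun p => ?_
      simp [weylGenAction, mul_left_comm]
    | d_comm i j =>
      simp only [map_mul, FreeAlgebra.lift_ι_apply, weylGenAction, Sum.elim_inr]
      have h0 : ⁅(MvPolynomial.pderiv i : Derivation R (MvPolynomial σ R) (MvPolynomial σ R)),
          (MvPolynomial.pderiv j : Derivation R (MvPolynomial σ R) (MvPolynomial σ R))⁆ = 0 := by
        refine MvPolynomial.derivation_ext fun k => ?_
        simp [Derivation.commutator_apply, MvPolynomial.pderiv_X, Pi.single_apply, apply_ite]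
      refine LinearMap.ext fun p => ?_
      have h1 := congrArg
        (fun D : Derivation R (MvPolynomial σ R) (MvPolynomial σ R) => D p) h0
      simpa [Derivation.commutator_apply, sub_eq_zero] using h1
    | d_x_same i =>
      refine LinearMap.ext fun p => ?_
      simp [weylGenAction, Derivation.leibniz]
    | d_x_ne i j h =>
      refine LinearMap.ext fun p => ?_
      simp [weylGenAction, Derivation.leibniz, MvPolynomial.pderiv_X_of_ne h.symm]⟩

/-- The action of the Weyl algebra with matrix coefficients `W ⊗ End V` on `S ⊗ V`:
`(a ⊗ b) (p ⊗ v) = (a p) ⊗ (b v)`. -/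
def weylMatrixAction (R : Type*) [CommRing R] (σ : Type*) (V : Type*) [AddCommGroup V]
    [Module R V] :
    WeylAlgebra R σ ⊗[R] Module.End R V →ₐ[R] Module.End R (MvPolynomial σ R ⊗[R] V) :=
  (Module.endTensorEndAlgHom (R := R) (S := R) (A := R) (M := MvPolynomial σ R) (N := V)).comp
    (Algebra.TensorProduct.map (weylAction R σ) (AlgHom.id R (Module.End R V)))

end Weyl

/-! ### Induced modules (generalized Verma modules) -/

section Induced

variable {R : Type*} [CommRing R] {L : Type*} [LieRing L] [LieAlgebra R L]

section

attribute [local instance 100] LieRing.ofAssociativeRing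

/-- The algebra homomorphism `U(𝔭) → U(L)` induced by the inclusion of a subalgebra. -/
def envelopingIncl (𝔭 : LieSubalgebra R L) :
    UniversalEnvelopingAlgebra R 𝔭 →ₐ[R] UniversalEnvelopingAlgebra R L :=
  UniversalEnvelopingAlgebra.lift R ((UniversalEnvelopingAlgebra.ι R).comp 𝔭.incl)

end

/-- The action of `U(𝔭)` on a `𝔭`-module. -/
def envelopingAction (𝔭 : LieSubalgebra R L) (V : Type*) [AddCommGroup V] [Module R V]
    [LieRingModule 𝔭 V] [LieModule R 𝔭 V] :
    UniversalEnvelopingAlgebra R 𝔭 →ₐ[R] Module.End R V :=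
  UniversalEnvelopingAlgebra.lift R (LieModule.toEnd R 𝔭 V)

/-- The relations `a b ⊗ v = a ⊗ b v` (`a ∈ U(L)`, `b ∈ U(𝔭)`, `v ∈ V`) which turn
`U(L) ⊗ V` into the tensor product over `U(𝔭)`. -/
def balancingRelations (𝔭 : LieSubalgebra R L) (V : Type*) [AddCommGroup V] [Module R V]
    [LieRingModule 𝔭 V] [LieModule R 𝔭 V] :
    Submodule (UniversalEnvelopingAlgebra R L) (UniversalEnvelopingAlgebra R L ⊗[R] V) :=
  Submodule.span _ {t | ∃ (a : UniversalEnvelopingAlgebra R L)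
    (b : UniversalEnvelopingAlgebra R 𝔭) (v : V),
    t = (a * envelopingIncl 𝔭 b) ⊗ₜ[R] v - a ⊗ₜ[R] (envelopingAction 𝔭 V b v)}

/-- The module `U(L) ⊗_{U(𝔭)} V` induced from the `𝔭`-module `V`. For a parabolic `𝔭` and an
irreducible module of the Levi part on which the nilradical acts by zero, this is the
generalized Verma module. -/
abbrev GenVerma (𝔭 : LieSubalgebra R L) (V : Type*) [AddCommGroup V] [Module R V]
    [LieRingModule 𝔭 V] [LieModule R 𝔭 V] : Type _ :=
  (UniversalEnvelopingAlgebra R L ⊗[R] V) ⧸ balancingRelations 𝔭 V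

/-- The element `a ⊗_{U(𝔭)} v` of the induced module. -/
def GenVerma.tmul (𝔭 : LieSubalgebra R L) {V : Type*} [AddCommGroup V] [Module R V]
    [LieRingModule 𝔭 V] [LieModule R 𝔭 V] (a : UniversalEnvelopingAlgebra R L) (v : V) :
    GenVerma 𝔭 V :=
  (balancingRelations 𝔭 V).mkQ (a ⊗ₜ[R] v)

/-- The ordered monomial `u₁ ^ a₁ * ⋯ * uₙ ^ aₙ` in `U(L)`. -/
def orderedMonomial {n : ℕ} (u : Fin n → L) (a : Fin n →₀ ℕ) : UniversalEnvelopingAlgebra R L :=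
  (List.ofFn fun i => UniversalEnvelopingAlgebra.ι R (u i) ^ a i).prod

end Induced

/-! ### Borel and parabolic subalgebras, nilradicals -/

section Parabolic

open LieAlgebra

variable {𝔤 : Type*} [LieRing 𝔤] [LieAlgebra ℂ 𝔤] [FiniteDimensional ℂ 𝔤]
  [LieAlgebra.IsSemisimple ℂ 𝔤]

/-- `𝔟` is a Borel subalgebra containing the Cartan subalgebra `H`: for some base of the root
system, `𝔟` is the sum of `H` and all positive root spaces. -/
def IsBorelSubalgebra (H : LieSubalgebra ℂ 𝔤) [H.IsCartanSubalgebra]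
    (𝔟 : LieSubalgebra ℂ 𝔤) : Prop :=
  ∃ Δ : (LieAlgebra.IsKilling.rootSystem H).Base,
    𝔟.toSubmodule =
      H.toSubmodule ⊔ ⨆ (α : H.root) (_ : Δ.IsPos α),
        (rootSpace H (α : LieModule.Weight ℂ H 𝔤)).toSubmodule

/-- `𝔭` is a parabolic subalgebra containing `H`: it contains a Borel subalgebra containing `H`. -/
def IsParabolicSubalgebra (H : LieSubalgebra ℂ 𝔤) [H.IsCartanSubalgebra]
    (𝔭 : LieSubalgebra ℂ 𝔤) : Prop :=
  ∃ 𝔟 : LieSubalgebra ℂ 𝔤, IsBorelSubalgebra H 𝔟 ∧ 𝔟 ≤ 𝔭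

/-- The roots of the nilradical of a parabolic `𝔭 ⊇ H`: the roots `α` of `𝔭` such that `-α`
is not a root of `𝔭`. (The roots `α` with both `α` and `-α` in `𝔭` are those of the Levi part.) -/
def nilradicalRoots (H : LieSubalgebra ℂ 𝔤) [H.IsCartanSubalgebra]
    (𝔭 : LieSubalgebra ℂ 𝔤) : Set (LieModule.Weight ℂ H 𝔤) :=
  {α | α.IsNonZero ∧ (rootSpace H α).toSubmodule ≤ 𝔭.toSubmodule ∧
    ¬ (rootSpace H (-α : LieModule.Weight ℂ H 𝔤)).toSubmodule ≤ 𝔭.toSubmodule}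

/-- The nilradical `𝔫` of a parabolic subalgebra `𝔭 ⊇ H`. -/
def parabolicNilradical (H : LieSubalgebra ℂ 𝔤) [H.IsCartanSubalgebra]
    (𝔭 : LieSubalgebra ℂ 𝔤) : LieSubalgebra ℂ 𝔤 :=
  LieSubalgebra.lieSpan ℂ 𝔤
    (⋃ α ∈ nilradicalRoots H 𝔭, (rootSpace H (α : LieModule.Weight ℂ H 𝔤) : Set 𝔤))

/-- The opposite nilradical `𝔫₋`: the subalgebra generated by the root spaces opposite to those
that generate the nilradical of `𝔭`. -/
def oppositeNilradical (H : LieSubalgebra ℂ 𝔤) [H.IsCartanSubalgebra]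
    (𝔭 : LieSubalgebra ℂ 𝔤) : LieSubalgebra ℂ 𝔤 :=
  LieSubalgebra.lieSpan ℂ 𝔤
    (⋃ α ∈ nilradicalRoots H 𝔭, (rootSpace H (-α : LieModule.Weight ℂ H 𝔤) : Set 𝔤))

end Parabolic

end

noncomputable section

/-! ### The Poincaré–Birkhoff–Witt theorem -/

section PBW

open UniversalEnvelopingAlgebra

variable {R : Type*} [CommRing R] {L : Type*} [LieRing L] [LieAlgebra R L]

/-! Three ingredients: a PBW basis adapted to 𝔤 = 𝔫₋ ⊕ 𝔭, a rule for moving a Lie algebra element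
through an ordered monomial, and faithfulness of 𝕎ₙ ⊗ End V on 𝕊ₙ ⊗ V.

PBW (`polyToEnv_injective`): 𝔤 has trivial center, so ad is faithful and 𝔤 embeds in U(𝔤). In
characteristic zero, independence of the ordered monomials then follows from the coproduct:
contracting its left leg with a functional dual to a basis vector acts on ordered monomials as a
partial derivative up to shorter products, so a relation could be differentiated down to a constant.
Applied to a basis u followed by a basis of 𝔭, this makes the induced module free on the monomials
in u with coefficients in V (`genVermaEquiv`).

Moving rule: y x^m = ∑ (m choose k) x^(m-k) (-ad x)^k y, and the binomial coefficient is the effect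
of ∂^k / k! on the exponent. So inserting y before a factor u_j^(a_j) equals inserting the elements
(-ad u_j)^k y after it, composed with divided powers of ∂_j (`insertMap_eq_sum`). Each ad u_j is
nilpotent, hence the sums are finite and the operators have finite order. Left multiplication by y
is insertion in position 0. It is pushed to the right end, where an element of 𝔭 acts on V alone.
Elements u_i that arrive at the right end are carried back to the place just before u_i^(a_i), where
insertion is multiplication by x_i; the brackets created on the way have larger root height, so a
downward induction on height terminates (`conj_lsmul_ι_mem_range`).

Thus U(𝔤) acts through the image of 𝕎ₙ ⊗ End V. That image is a faithful copy
(`weylMatrixAction_injective`, by triangularity of normally ordered operators on monomials), so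
inverting the action defines Φ. For simple 𝔤 the kernel on 𝔤 is an ideal, and it is proper because
u_i sends 1 ⊗ v to x_i ⊗ v. -/

lemma enveloping_ι_lie (x y : L) : ι R ⁅x, y⁆ = ι R x * ι R y - ι R y * ι R x := by
  let _ : LieRing (UniversalEnvelopingAlgebra R L) := LieRing.ofAssociativeRing
  rw [LieHom.map_lie]; rfl

variable (R L) in
/-- The span of the products of fewer than `d` elements of `L` in the enveloping algebra. -/
def envFiltration (d : ℕ) : Submodule R (UniversalEnvelopingAlgebra R L) :=
  Submodule.span R {w | ∃ l : List L, l.length < d ∧ (l.map (ι R)).prod = w}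

lemma envFiltration_mono {c d : ℕ} (h : c ≤ d) : envFiltration R L c ≤ envFiltration R L d :=
  Submodule.span_mono fun _ ⟨l, hl, hw⟩ => ⟨l, hl.trans_le h, hw⟩

lemma prod_mem_envFiltration (l : List L) {d : ℕ} (h : l.length < d) :
    (l.map (ι R)).prod ∈ envFiltration R L d :=
  Submodule.subset_span ⟨l, h, rfl⟩

/-- The strict length bound makes level zero trivial, which starts the inductions below and keeps
truncated indices `d - 1` harmless. -/
lemma envFiltration_zero : envFiltration R L 0 = ⊥ := by
  simp [envFiltration]

lemma ι_mul_mem_envFiltration (x : L) {d : ℕ} {w : UniversalEnvelopingAlgebra R L}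
    (h : w ∈ envFiltration R L d) : ι R x * w ∈ envFiltration R L (d + 1) := by
  induction h using Submodule.span_induction with
  | mem w hw =>
    obtain ⟨l, hl, rfl⟩ := hw
    exact Submodule.subset_span ⟨x :: l, by simpa using hl, by simp⟩
  | zero => simp
  | add u v _ _ hu hv => rw [mul_add]; exact add_mem hu hv
  | smul c u _ hu => rw [mul_smul_comm]; exact Submodule.smul_mem _ _ hu

lemma ι_mul_mem_envFiltration_of_pred (x : L) {d : ℕ} {w : UniversalEnvelopingAlgebra R L}
    (h : w ∈ envFiltration R L (d - 1)) : ι R x * w ∈ envFiltration R L d := by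
  rcases d with _ | d
  · rw [Nat.zero_sub, envFiltration_zero, Submodule.mem_bot] at h
    simp [h]
  · exact ι_mul_mem_envFiltration x h

lemma exists_mem_envFiltration (w : UniversalEnvelopingAlgebra R L) :
    ∃ d, w ∈ envFiltration R L d := by
  have key : ∀ t : TensorAlgebra R L, ∃ d, mkAlgHom R L t ∈ envFiltration R L d := by
    intro t
    have ht : t ∈ Submodule.span R
        (Submonoid.closure (Set.range (TensorAlgebra.ι R : L → TensorAlgebra R L)) :
          Set (TensorAlgebra R L)) := by
      rw [← Algebra.adjoin_eq_span, TensorAlgebra.adjoin_range_ι]; trivial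
    induction ht using Submodule.span_induction with
    | mem t ht =>
      induction ht using Submonoid.closure_induction_left with
      | one => exact ⟨1, by rw [map_one]; exact prod_mem_envFiltration (R := R) ([] : List L) (by simp)⟩
      | mul_left t ht s _ hs =>
        obtain ⟨x, rfl⟩ := ht
        obtain ⟨d, hd⟩ := hs
        exact ⟨d + 1, by rw [map_mul]; exact ι_mul_mem_envFiltration x hd⟩
    | zero => exact ⟨0, by simp⟩
    | add u v _ _ hu hv =>
      obtain ⟨c, hc⟩ := hu
      obtain ⟨d, hd⟩ := hv
      exact ⟨max c d, by
        rw [map_add]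
        exact add_mem (envFiltration_mono (le_max_left _ _) hc)
          (envFiltration_mono (le_max_right _ _) hd)⟩
    | smul r u _ hu =>
      obtain ⟨d, hd⟩ := hu
      exact ⟨d, by rw [map_smul]; exact Submodule.smul_mem _ _ hd⟩
  obtain ⟨t, rfl⟩ : ∃ t, mkAlgHom R L t = w := RingCon.mkₐ_surjective _ w
  exact key t

/-- Reordering a product changes it by shorter products only. -/
lemma prod_sub_prod_mem_of_perm {l l' : List L} (h : l.Perm l') :
    (l.map (ι R)).prod - (l'.map (ι R)).prod ∈ envFiltration R L l.length := by
  induction h with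
  | nil => simp
  | cons x _ ih => simpa [mul_sub] using ι_mul_mem_envFiltration x ih
  | swap x y l =>
    -- An adjacent swap costs yx - xy = [y, x], which merges two factors into one.
    have h : (((y :: x :: l).map (ι R)).prod - ((x :: y :: l).map (ι R)).prod) =
        ((⁅y, x⁆ :: l).map (ι R)).prod := by
      simp only [List.map_cons, List.prod_cons, enveloping_ι_lie, sub_mul, mul_assoc]
    rw [h]
    exact prod_mem_envFiltration _ (by simp)
  | trans h₁ _ ih₁ ih₂ =>
    rw [← h₁.length_eq] at ih₂
    simpa using add_mem ih₁ ih₂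

@[elab_as_elim]
lemma exponent_induction {σ : Type*} {p : (σ →₀ ℕ) → Prop} (zero : p 0)
    (add_single : ∀ b j, p b → p (b + Finsupp.single j 1)) (a : σ →₀ ℕ) : p a := by
  classical
  induction h : a.degree generalizing a with
  | zero =>
    rw [Finsupp.degree_eq_zero_iff] at h
    exact h ▸ zero
  | succ d ih =>
    have ha : a ≠ 0 := fun h0 => by simp [h0] at h
    obtain ⟨i, hi⟩ := Finsupp.ne_iff.1 ha
    have hle : Finsupp.single i 1 ≤ a := by
      simpa [Finsupp.single_le_iff] using Nat.one_le_iff_ne_zero.2 hi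
    rw [← tsub_add_cancel_of_le hle] at h ⊢
    rw [map_add, Finsupp.degree_single] at h
    exact add_single _ _ (ih _ (by omega))

/-! ### Ordered monomials, total degree and spanning -/

section Monomial

variable {N : ℕ}

/-- The weakly increasing list in which `i` occurs `a i` times. -/
def exponentList (a : Fin N →₀ ℕ) : List (Fin N) :=
  (List.ofFn fun i => List.replicate (a i) i).flatten

lemma count_exponentList (a : Fin N →₀ ℕ) (i : Fin N) : (exponentList a).count i = a i := by
  simp [exponentList, List.count_flatten, List.map_ofFn, List.sum_ofFn, List.count_replicate,
    Function.comp_def]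

lemma length_exponentList (a : Fin N →₀ ℕ) : (exponentList a).length = a.degree := by
  simp [exponentList, List.length_flatten, List.map_ofFn, List.sum_ofFn, Function.comp_def,
    Finsupp.degree_eq_sum]

lemma orderedMonomial_eq_prod (e : Fin N → L) (a : Fin N →₀ ℕ) :
    (orderedMonomial e a : UniversalEnvelopingAlgebra R L) =
      (((exponentList a).map e).map (ι R)).prod := by
  simp [orderedMonomial, exponentList, List.map_flatten, List.map_ofFn, List.prod_flatten,
    Function.comp_def]

lemma orderedMonomial_zero (e : Fin N → L) :
    (orderedMonomial e 0 : UniversalEnvelopingAlgebra R L) = 1 := by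
  simp [orderedMonomial]

/-- The linear map sending a monomial to the corresponding ordered monomial. -/
def polyToEnv (e : Fin N → L) : MvPolynomial (Fin N) R →ₗ[R] UniversalEnvelopingAlgebra R L :=
  (MvPolynomial.basisMonomials (Fin N) R).constr R (orderedMonomial e)

lemma polyToEnv_monomial (e : Fin N → L) (a : Fin N →₀ ℕ) :
    polyToEnv (R := R) e (MvPolynomial.monomial a 1) = orderedMonomial e a := by
  rw [polyToEnv, show MvPolynomial.monomial a (1 : R) = MvPolynomial.basisMonomials (Fin N) R a by simp,
    Module.Basis.constr_basis]

variable (R N) in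
/-- The polynomials of total degree less than `d`. -/
def degreeLT (d : ℕ) : Submodule R (MvPolynomial (Fin N) R) :=
  MvPolynomial.restrictSupport R {a | a.degree < d}

lemma mem_degreeLT {d : ℕ} {f : MvPolynomial (Fin N) R} :
    f ∈ degreeLT R N d ↔ ∀ a : Fin N →₀ ℕ, d ≤ a.degree → f.coeff a = 0 := by
  simp only [degreeLT, MvPolynomial.mem_restrictSupport_iff, Set.subset_def, Finset.mem_coe,
    MvPolynomial.mem_support_iff, Set.mem_ofPred_eq]
  exact forall_congr' fun a => by rw [← not_lt, not_imp_comm]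

lemma degreeLT_eq_span (d : ℕ) : degreeLT R N d =
    Submodule.span R ((MvPolynomial.monomial · 1) '' {a | a.degree < d}) :=
  MvPolynomial.restrictSupport_eq_span _ _

lemma monomial_mem_degreeLT {d : ℕ} {a : Fin N →₀ ℕ} (h : a.degree < d) (r : R) :
    MvPolynomial.monomial a r ∈ degreeLT R N d :=
  (MvPolynomial.monomial_mem_restrictSupport R).2 (Or.inl h)

lemma degreeLT_mono {c d : ℕ} (h : c ≤ d) : degreeLT R N c ≤ degreeLT R N d :=
  MvPolynomial.restrictSupport_mono _ fun _ ha => lt_of_lt_of_le ha h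

lemma exists_mem_degreeLT (f : MvPolynomial (Fin N) R) : ∃ d, f ∈ degreeLT R N d := by
  induction f using MvPolynomial.induction_on' with
  | monomial a r => exact ⟨a.degree + 1, monomial_mem_degreeLT (Nat.lt_succ_self _) r⟩
  | add p q hp hq =>
    obtain ⟨c, hc⟩ := hp
    obtain ⟨d, hd⟩ := hq
    exact ⟨max c d, add_mem (degreeLT_mono (le_max_left _ _) hc)
      (degreeLT_mono (le_max_right _ _) hd)⟩

lemma map_mem_of_mem_degreeLT {M : Type*} [AddCommGroup M] [Module R M] {d : ℕ}
    (g : MvPolynomial (Fin N) R →ₗ[R] M) {W : Submodule R M}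
    (h : ∀ a : Fin N →₀ ℕ, a.degree < d → g (MvPolynomial.monomial a 1) ∈ W)
    {f : MvPolynomial (Fin N) R} (hf : f ∈ degreeLT R N d) : g f ∈ W := by
  rw [degreeLT_eq_span] at hf
  refine (Submodule.span_le (p := W.comap g)).2 ?_ hf
  rintro _ ⟨a, ha, rfl⟩
  exact h a ha

lemma X_mul_mem_degreeLT (j : Fin N) {d : ℕ} {f : MvPolynomial (Fin N) R}
    (hf : f ∈ degreeLT R N d) : MvPolynomial.X j * f ∈ degreeLT R N (d + 1) := by
  refine map_mem_of_mem_degreeLT (LinearMap.mulLeft R (MvPolynomial.X j)) (fun a ha => ?_) hf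
  rw [LinearMap.mulLeft_apply, MvPolynomial.X, MvPolynomial.monomial_mul]
  exact monomial_mem_degreeLT (by rw [map_add, Finsupp.degree_single]; omega) _

lemma pderiv_mem_degreeLT (j : Fin N) {d : ℕ} {f : MvPolynomial (Fin N) R}
    (hf : f ∈ degreeLT R N (d + 1)) : MvPolynomial.pderiv j f ∈ degreeLT R N d := by
  rw [mem_degreeLT] at hf ⊢
  intro a ha
  rw [MvPolynomial.coeff_pderiv, hf _ (by rw [map_add, Finsupp.degree_single]; omega), zero_mul]

lemma orderedMonomial_mem_envFiltration (e : Fin N → L) {a : Fin N →₀ ℕ} {d : ℕ}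
    (h : a.degree < d) : orderedMonomial e a ∈ envFiltration R L d := by
  rw [orderedMonomial_eq_prod]
  exact prod_mem_envFiltration _ (by simpa [length_exponentList] using h)

lemma polyToEnv_mem_envFiltration (e : Fin N → L) {d : ℕ} {f : MvPolynomial (Fin N) R}
    (hf : f ∈ degreeLT R N d) : polyToEnv e f ∈ envFiltration R L d := by
  refine map_mem_of_mem_degreeLT (polyToEnv e) (fun a ha => ?_) hf
  rw [polyToEnv_monomial]
  exact orderedMonomial_mem_envFiltration e ha

/-- Prepending j to the sorted list of b gives a permutation of the sorted list of b + e_j, so only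
reordering terms appear. -/
lemma ι_mul_orderedMonomial_sub_mem (e : Fin N → L) (j : Fin N) (b : Fin N →₀ ℕ) :
    ι R (e j) * orderedMonomial e b - orderedMonomial e (b + Finsupp.single j 1) ∈
      envFiltration R L (b.degree + 1) := by
  have hp : (j :: exponentList b).Perm (exponentList (b + Finsupp.single j 1)) := by
    rw [List.perm_iff_count]
    intro i
    rw [List.count_cons, count_exponentList, count_exponentList]
    by_cases h : j = i <;> simp [h]
  have := prod_sub_prod_mem_of_perm (R := R) (hp.map e)
  simpa [orderedMonomial_eq_prod, length_exponentList] using this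

lemma ι_mul_polyToEnv_sub_mem (e : Fin N → L) (j : Fin N) {d : ℕ} {f : MvPolynomial (Fin N) R}
    (hf : f ∈ degreeLT R N d) :
    ι R (e j) * polyToEnv e f - polyToEnv e (MvPolynomial.X j * f) ∈ envFiltration R L d := by
  refine map_mem_of_mem_degreeLT (LinearMap.mulLeft R (ι R (e j)) ∘ₗ polyToEnv e -
    polyToEnv e ∘ₗ LinearMap.mulLeft R (MvPolynomial.X j)) (fun a ha => ?_) hf
  have := ι_mul_orderedMonomial_sub_mem (R := R) e j a
  simp only [LinearMap.sub_apply, LinearMap.comp_apply, LinearMap.mulLeft_apply]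
  rw [MvPolynomial.X, MvPolynomial.monomial_mul, one_mul, polyToEnv_monomial,
    polyToEnv_monomial, add_comm]
  exact envFiltration_mono ha this

/-- The ordered monomials in a generating family of `L` span the enveloping algebra. -/
lemma exists_polyToEnv_eq (e : Fin N → L) (he : Submodule.span R (Set.range e) = ⊤) (d : ℕ)
    {w : UniversalEnvelopingAlgebra R L} (hw : w ∈ envFiltration R L d) :
    ∃ f ∈ degreeLT R N d, polyToEnv e f = w := by
  suffices h : envFiltration R L d ≤ (degreeLT R N d).map (polyToEnv e) from h hw
  clear hw w
  induction d with
  | zero => simp [envFiltration_zero]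
  | succ d ih =>
    refine Submodule.span_le.2 ?_
    rintro _ ⟨l, hl, rfl⟩
    rw [Nat.lt_succ_iff] at hl
    rcases l with _ | ⟨x, l⟩
    · refine ⟨MvPolynomial.monomial 0 1, monomial_mem_degreeLT (by simp) _, ?_⟩
      rw [polyToEnv_monomial, orderedMonomial_zero]; simp
    · obtain ⟨f, hf, hfe⟩ := ih (prod_mem_envFiltration (R := R) l (by simpa using hl))
      rw [List.map_cons, List.prod_cons, ← hfe, SetLike.mem_coe]
      clear hl
      have hx : x ∈ Submodule.span R (Set.range e) := he ▸ Submodule.mem_top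
      induction hx using Submodule.span_induction with
      | mem x hx =>
        obtain ⟨j, rfl⟩ := hx
        -- The reordering error lies one level lower, where the induction hypothesis rewrites it in
        -- ordered monomials.
        have h1 := ih (ι_mul_polyToEnv_sub_mem (R := R) e j hf)
        have := add_mem (Submodule.map_mono (degreeLT_mono (Nat.le_succ _)) h1)
          (Submodule.mem_map_of_mem (f := polyToEnv (R := R) e) (X_mul_mem_degreeLT j hf))
        simpa using this
      | zero => simp
      | add y z _ _ hy hz => rw [map_add, add_mul]; exact add_mem hy hz
      | smul c y _ hy => rw [map_smul, smul_mul_assoc]; exact Submodule.smul_mem _ _ hy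

lemma polyToEnv_surjective (e : Fin N → L) (he : Submodule.span R (Set.range e) = ⊤) :
    Function.Surjective (polyToEnv (R := R) e) := fun w => by
  obtain ⟨d, hd⟩ := exists_mem_envFiltration w
  obtain ⟨f, -, hf⟩ := exists_polyToEnv_eq e he d hd
  exact ⟨f, hf⟩

end Monomial

/-! ### Coproduct, counit and contraction with functionals -/

section Coproduct

attribute [local instance 100] LieRing.ofAssociativeRing

variable (R L) in
/-- The coproduct of the enveloping algebra, for which the elements of `L` are primitive. -/
def envCoproduct : UniversalEnvelopingAlgebra R L →ₐ[R]
    UniversalEnvelopingAlgebra R L ⊗[R] UniversalEnvelopingAlgebra R L :=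
  lift R
    { toLinearMap := (TensorProduct.mk R _ _).flip 1 ∘ₗ (ι R : L →ₗ⁅R⁆ _).toLinearMap +
        TensorProduct.mk R _ _ 1 ∘ₗ (ι R : L →ₗ⁅R⁆ _).toLinearMap
      map_lie' := fun {x y} => by
        simp [-UniversalEnvelopingAlgebra.ι_apply, LieRing.of_associative_ring_bracket,
          mul_add, add_mul, TensorProduct.tmul_sub]
        abel }

lemma envCoproduct_ι (x : L) : envCoproduct R L (ι R x) = ι R x ⊗ₜ 1 + 1 ⊗ₜ ι R x :=
  lift_ι_apply R _ x

variable (R L) in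
/-- The augmentation of the enveloping algebra. -/
def envCounit : UniversalEnvelopingAlgebra R L →ₐ[R] R := lift R 0

lemma envCounit_ι (x : L) : envCounit R L (ι R x) = 0 :=
  lift_ι_apply R _ x

end Coproduct

/-- The contraction of the left factor of the coproduct with a linear functional. -/
def envContract (ξ : UniversalEnvelopingAlgebra R L →ₗ[R] R) :
    UniversalEnvelopingAlgebra R L →ₗ[R] UniversalEnvelopingAlgebra R L :=
  (TensorProduct.lid R _).toLinearMap ∘ₗ ξ.rTensor _ ∘ₗ (envCoproduct R L).toLinearMap

lemma envContract_one (ξ : UniversalEnvelopingAlgebra R L →ₗ[R] R) :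
    envContract ξ 1 = ξ 1 • 1 := by
  simp [envContract, Algebra.TensorProduct.one_def]

/-- Since x is primitive, Δ(xw) = (x ⊗ 1 + 1 ⊗ x) Δ(w): x is either absorbed into the functional or
stays in the right leg. -/
lemma envContract_ι_mul (ξ : UniversalEnvelopingAlgebra R L →ₗ[R] R) (x : L)
    (w : UniversalEnvelopingAlgebra R L) :
    envContract ξ (ι R x * w) =
      envContract (ξ ∘ₗ LinearMap.mulLeft R (ι R x)) w + ι R x * envContract ξ w := by
  simp only [envContract, LinearMap.comp_apply, AlgHom.toLinearMap_apply, map_mul,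
    envCoproduct_ι, LinearEquiv.coe_coe]
  generalize envCoproduct R L w = t
  induction t using TensorProduct.induction_on with
  | zero => simp
  | tmul a b => simp [-UniversalEnvelopingAlgebra.ι_apply, add_mul]
  | add s t hs ht => simp only [mul_add, map_add, hs, ht]; abel

/-- In the coproduct of a product, only the term 1 ⊗ w keeps all factors in the right leg; every
other right leg is shorter. -/
lemma envContract_prod_sub_mem (ξ : UniversalEnvelopingAlgebra R L →ₗ[R] R) (l : List L) :
    envContract ξ (l.map (ι R)).prod - ξ 1 • (l.map (ι R)).prod ∈
      envFiltration R L l.length := by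
  induction l generalizing ξ with
  | nil => simp [envContract_one]
  | cons x l ih =>
    rw [List.map_cons, List.prod_cons, envContract_ι_mul]
    have h1 := envFiltration_mono (Nat.le_succ _) (ih (ξ ∘ₗ LinearMap.mulLeft R (ι R x)))
    have h2 := ι_mul_mem_envFiltration x (ih ξ)
    have h3 := Submodule.smul_mem _ ((ξ ∘ₗ LinearMap.mulLeft R (ι R x)) 1)
      (prod_mem_envFiltration (R := R) l (Nat.lt_succ_self _))
    have := add_mem (add_mem h1 h2) h3
    rw [mul_sub, mul_smul_comm] at this
    have hab : ∀ A B C D : UniversalEnvelopingAlgebra R L,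
      A + B - D = A - C + (B - D) + C := by intros; abel
    exact (congrArg (· ∈ envFiltration R L (l.length + 1)) (hab _ _ _ _)).mpr this

lemma envContract_sub_mem (ξ : UniversalEnvelopingAlgebra R L →ₗ[R] R) {d : ℕ}
    {w : UniversalEnvelopingAlgebra R L} (hw : w ∈ envFiltration R L d) :
    envContract ξ w - ξ 1 • w ∈ envFiltration R L (d - 1) := by
  refine (Submodule.span_le (p := (envFiltration R L (d - 1)).comap
    (envContract ξ - ξ 1 • LinearMap.id))).2 ?_ hw
  rintro _ ⟨l, hl, rfl⟩
  exact envFiltration_mono (Nat.le_sub_one_of_lt hl) (envContract_prod_sub_mem ξ l)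

/-! ### Contraction as a partial derivative on symbols -/

section Injective

variable {N : ℕ}

/-- To leading order the contraction satisfies the Leibniz rule: a factor e_j is either evaluated by
ξ, giving δ_ij, or left in place. The error is one level below the derivative itself. -/
lemma envContract_polyToEnv_sub_mem (e : Fin N → L) (i : Fin N)
    (ξ : UniversalEnvelopingAlgebra R L →ₗ[R] R) (h1 : ξ 1 = 0)
    (hξ : ∀ j, ξ (ι R (e j)) = if j = i then 1 else 0) (a : Fin N →₀ ℕ) :
    envContract ξ (polyToEnv e (MvPolynomial.monomial a 1)) -
      polyToEnv e (MvPolynomial.pderiv i (MvPolynomial.monomial a 1)) ∈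
        envFiltration R L (a.degree - 1) := by
  induction a using exponent_induction with
  | zero =>
    rw [polyToEnv_monomial, orderedMonomial_zero, envContract_one, h1]
    simp
  | add_single b j ih =>
    have hdeg : (b + Finsupp.single j 1).degree - 1 = b.degree := by
      rw [map_add, Finsupp.degree_single]; omega
    rw [hdeg]
    have hX : MvPolynomial.monomial (b + Finsupp.single j 1) (1 : R) =
        MvPolynomial.X j * MvPolynomial.monomial b 1 := by
      rw [MvPolynomial.X, MvPolynomial.monomial_mul, one_mul, add_comm]
    rw [hX]
    set f := MvPolynomial.monomial b (1 : R) with hf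
    have hfd : f ∈ degreeLT R N (b.degree + 1) := monomial_mem_degreeLT (Nat.lt_succ_self _) _
    -- `s1` and `s4` account for reordering before and after differentiation, `s2` for the factor
    -- evaluated by ξ, `s3` for the inductive error.
    have s1 := envContract_sub_mem ξ (ι_mul_polyToEnv_sub_mem e j hfd)
    rw [h1, zero_smul, sub_zero, map_sub, envContract_ι_mul] at s1
    have s2 := envContract_sub_mem (ξ ∘ₗ LinearMap.mulLeft R (ι R (e j)))
      (polyToEnv_mem_envFiltration e hfd)
    have s3 := ι_mul_mem_envFiltration_of_pred (e j) ih
    have s4 := ι_mul_polyToEnv_sub_mem e j (pderiv_mem_degreeLT i hfd)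
    have hd : MvPolynomial.pderiv i (MvPolynomial.X j * f) =
        MvPolynomial.X j * MvPolynomial.pderiv i f + (if j = i then (1 : R) else 0) • f := by
      rw [Derivation.leibniz, MvPolynomial.pderiv_X]
      by_cases h : j = i
      · subst h; simp
      · simp [h]
    rw [LinearMap.comp_apply, LinearMap.mulLeft_apply, mul_one, hξ] at s2
    rw [hd, map_add, map_smul]
    rw [Nat.add_sub_cancel] at s1 s2
    rw [mul_sub] at s3
    have := add_mem (sub_mem s2 s1) (add_mem s3 s4)
    convert this using 1
    exact (by intros; abel : ∀ A B C D E F : UniversalEnvelopingAlgebra R L,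
      A - (B + C) = D - C - (D + E - A) + (E - F + (F - B))) _ _ _ _ _ _

end Injective

end PBW

/-! ### The Poincaré–Birkhoff–Witt basis in characteristic zero -/

section PBWField

open UniversalEnvelopingAlgebra

variable {K : Type*} [Field K] {L : Type*} [LieRing L] [LieAlgebra K L]

attribute [local instance 100] LieRing.ofAssociativeRing in
-- A linear left inverse of `ι` extends the coordinate functional; subtracting a multiple of the
-- counit, which kills L, corrects the value at 1.
lemma exists_functional_dual {N : ℕ} (e : Module.Basis (Fin N) K L)
    (hι : Function.Injective (ι K : L → UniversalEnvelopingAlgebra K L)) (i : Fin N) :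
    ∃ ξ : UniversalEnvelopingAlgebra K L →ₗ[K] K, ξ 1 = 0 ∧
      ∀ j, ξ (ι K (e j)) = if j = i then 1 else 0 := by
  obtain ⟨g, hg⟩ := LinearMap.exists_leftInverse_of_injective
    ((ι K : L →ₗ⁅K⁆ _) : L →ₗ[K] UniversalEnvelopingAlgebra K L) (LinearMap.ker_eq_bot.2 hι)
  have hg' : ∀ x, g (ι K x) = x := fun x => LinearMap.congr_fun hg x
  refine ⟨e.coord i ∘ₗ g - (e.coord i (g 1)) • (envCounit K L).toLinearMap, by simp, fun j => ?_⟩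
  simp [-UniversalEnvelopingAlgebra.ι_apply, envCounit_ι, hg', Finsupp.single_apply]

variable [CharZero K]

/-- Ordered monomials in a basis of a Lie algebra which embeds into its enveloping algebra are
linearly independent. -/
theorem polyToEnv_injective {N : ℕ} (e : Module.Basis (Fin N) K L)
    (hι : Function.Injective (ι K : L → UniversalEnvelopingAlgebra K L)) :
    Function.Injective (polyToEnv (R := K) e) := by
  rw [injective_iff_map_eq_zero]
  intro f hf
  obtain ⟨d, hd⟩ := exists_mem_degreeLT f
  induction d generalizing f with
  | zero => ext a; simpa using mem_degreeLT.1 hd a (Nat.zero_le _)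
  | succ d ih =>
    -- It suffices to kill the coefficients of exact degree d. The constant case is detected by the
    -- counit, the others by differentiating in a variable that occurs.
    refine ih f hf (mem_degreeLT.2 fun a ha => ?_)
    rcases ha.lt_or_eq with ha | ha
    · exact mem_degreeLT.1 hd a ha
    by_cases ha0 : a = 0
    · subst ha0
      have hd0 : d = 0 := by simpa using ha
      subst hd0
      have hfC : f = MvPolynomial.C (f.coeff 0) := by
        ext b
        rw [MvPolynomial.coeff_C]
        split_ifs with hb
        · rw [hb]
        · refine mem_degreeLT.1 hd b (Nat.one_le_iff_ne_zero.2 fun h => hb ?_)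
          rw [Finsupp.degree_eq_zero_iff] at h
          exact h.symm
      have h1 : polyToEnv (R := K) e f = f.coeff 0 • 1 := by
        conv_lhs => rw [hfC, ← mul_one (f.coeff 0), MvPolynomial.C_mul, ← MvPolynomial.smul_eq_C_mul,
          map_smul, MvPolynomial.C_apply, polyToEnv_monomial, orderedMonomial_zero]
      rw [hf] at h1
      simpa using congrArg (envCounit K L) h1.symm
    · obtain ⟨i, hi⟩ := Finsupp.ne_iff.1 ha0
      obtain ⟨b, rfl⟩ : ∃ b, a = b + Finsupp.single i 1 :=
        ⟨a - Finsupp.single i 1, (tsub_add_cancel_of_le (by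
          simpa [Finsupp.single_le_iff] using Nat.one_le_iff_ne_zero.2 hi)).symm⟩
      rw [map_add, Finsupp.degree_single] at ha
      obtain ⟨ξ, hξ1, hξ⟩ := exists_functional_dual e hι i
      have hmem : envContract ξ (polyToEnv (R := K) e f) -
          polyToEnv (R := K) e (MvPolynomial.pderiv i f) ∈ envFiltration K L (d - 1) :=
        map_mem_of_mem_degreeLT (envContract ξ ∘ₗ polyToEnv (R := K) e -
          polyToEnv (R := K) e ∘ₗ (MvPolynomial.pderiv i).toLinearMap)
          (fun a ha => envFiltration_mono (by omega)
            (envContract_polyToEnv_sub_mem e i ξ hξ1 hξ a)) hd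
      obtain ⟨g, hg, hge⟩ := exists_polyToEnv_eq e e.span_eq _ hmem
      rw [hf, map_zero, zero_sub] at hge
      -- Contracting the relation gives a relation of lower degree with leading part ∂_i f; since g
      -- has degree below d - 1, it does not touch the coefficient at b.
      have h0 : MvPolynomial.pderiv i f + g = 0 := by
        refine ih _ ?_ (add_mem (pderiv_mem_degreeLT i hd) (degreeLT_mono (by omega) hg))
        rw [map_add, hge, add_neg_cancel]
      have h2 := congrArg (MvPolynomial.coeff b) h0
      rw [MvPolynomial.coeff_add, MvPolynomial.coeff_pderiv, mem_degreeLT.1 hg b (by omega),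
        add_zero, MvPolynomial.coeff_zero] at h2
      -- Differentiation multiplied the coefficient by b_i + 1, which is nonzero in characteristic
      -- zero.
      exact (mul_eq_zero.1 h2).resolve_right (by exact_mod_cast Nat.succ_ne_zero (b i))

/-- The Poincaré–Birkhoff–Witt basis of the enveloping algebra. -/
def pbwEquiv {N : ℕ} (e : Module.Basis (Fin N) K L)
    (hι : Function.Injective (ι K : L → UniversalEnvelopingAlgebra K L)) :
    MvPolynomial (Fin N) K ≃ₗ[K] UniversalEnvelopingAlgebra K L :=
  LinearEquiv.ofBijective (polyToEnv e)
    ⟨polyToEnv_injective e hι, polyToEnv_surjective e e.span_eq⟩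

lemma pbwEquiv_apply {N : ℕ} (e : Module.Basis (Fin N) K L)
    (hι : Function.Injective (ι K : L → UniversalEnvelopingAlgebra K L))
    (f : MvPolynomial (Fin N) K) : pbwEquiv e hι f = polyToEnv e f := rfl

end PBWField

end

noncomputable section

/-! ### Faithfulness of the action of the Weyl algebra with matrix coefficients -/

section WeylFaithful

open MvPolynomial

section PolyHom

variable {R : Type*} [CommRing R] {σ : Type*} {A : Type*} [Ring A] [Algebra R A]

open scoped IsMulCommutative in
/-- Evaluation of polynomials at a commuting family of elements of an algebra. -/
def polyHom (f : σ → A) (h : ∀ i j, f i * f j = f j * f i) : MvPolynomial σ R →ₐ[R] A :=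
  have : IsMulCommutative (Algebra.adjoin R (Set.range f)) := Algebra.isMulCommutative_adjoin R (by
    rintro _ ⟨i, rfl⟩ _ ⟨j, rfl⟩; exact h i j)
  (Algebra.adjoin R (Set.range f)).val.comp
    (aeval fun i => (⟨f i, Algebra.subset_adjoin ⟨i, rfl⟩⟩ : Algebra.adjoin R (Set.range f)))

open scoped IsMulCommutative in
lemma polyHom_X (f : σ → A) (h : ∀ i j, f i * f j = f j * f i) (i : σ) :
    polyHom (R := R) f h (X i) = f i := by
  have : IsMulCommutative (Algebra.adjoin R (Set.range f)) := Algebra.isMulCommutative_adjoin R (by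
    rintro _ ⟨i, rfl⟩ _ ⟨j, rfl⟩; exact h i j)
  exact congrArg Subtype.val (aeval_X (R := R)
    (fun i => (⟨f i, Algebra.subset_adjoin ⟨i, rfl⟩⟩ : Algebra.adjoin R (Set.range f))) i)

end PolyHom

/-! ### Normal ordering in the Weyl algebra -/

section Ring

variable (R : Type*) [CommRing R] {σ : Type*}

/-- The generator `x i` of the Weyl algebra. -/
def weylX (i : σ) : WeylAlgebra R σ :=
  RingQuot.mkAlgHom R (WeylRel R σ) (FreeAlgebra.ι R (Sum.inl i))

/-- The generator `∂ i` of the Weyl algebra. -/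
def weylD (i : σ) : WeylAlgebra R σ :=
  RingQuot.mkAlgHom R (WeylRel R σ) (FreeAlgebra.ι R (Sum.inr i))

lemma weylX_comm (i j : σ) : weylX R i * weylX R j = weylX R j * weylX R i := by
  simpa [weylX] using RingQuot.mkAlgHom_rel R (WeylRel.x_comm (R := R) i j)

lemma weylD_comm (i j : σ) : weylD R i * weylD R j = weylD R j * weylD R i := by
  simpa [weylD] using RingQuot.mkAlgHom_rel R (WeylRel.d_comm (R := R) i j)

lemma weylD_mul_weylX_self (i : σ) : weylD R i * weylX R i = weylX R i * weylD R i + 1 := by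
  have := RingQuot.mkAlgHom_rel R (WeylRel.d_x_same (R := R) i)
  rw [map_sub, map_mul, map_mul, map_one, sub_eq_iff_eq_add'] at this
  exact this

lemma weylD_mul_weylX_of_ne {i j : σ} (h : j ≠ i) :
    weylD R j * weylX R i = weylX R i * weylD R j := by
  have := RingQuot.mkAlgHom_rel R (WeylRel.d_x_ne (R := R) i j h)
  rw [map_sub, map_mul, map_mul, map_zero, sub_eq_zero] at this
  exact this

lemma weylAction_weylX (i : σ) : weylAction R σ (weylX R i) = LinearMap.mulLeft R (X i) := by
  simp [weylAction, weylX, weylGenAction]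

lemma weylAction_weylD (i : σ) : weylAction R σ (weylD R i) = (pderiv i).toLinearMap := by
  simp [weylAction, weylD, weylGenAction]

variable (σ) in
/-- Polynomials in the `x i`, as elements of the Weyl algebra. -/
def weylPolyX : MvPolynomial σ R →ₐ[R] WeylAlgebra R σ := polyHom (weylX R) (weylX_comm R)

variable (σ) in
/-- Polynomials in the `∂ i`, as elements of the Weyl algebra. -/
def weylPolyD : MvPolynomial σ R →ₐ[R] WeylAlgebra R σ := polyHom (weylD R) (weylD_comm R)

lemma weylPolyX_X (i : σ) : weylPolyX R σ (X i) = weylX R i := polyHom_X _ _ i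

lemma weylPolyD_X (i : σ) : weylPolyD R σ (X i) = weylD R i := polyHom_X _ _ i

lemma weylAction_weylPolyX (p q : MvPolynomial σ R) : weylAction R σ (weylPolyX R σ p) q = p * q := by
  have : (weylAction R σ).comp (weylPolyX R σ) = Algebra.lmul R _ := by
    ext i : 1
    rw [AlgHom.comp_apply, weylPolyX_X, weylAction_weylX]; rfl
  exact LinearMap.congr_fun (AlgHom.congr_fun this p) q

/-- This is the commutator [∂_i, p] = ∂p/∂x_i, which moves derivations to the right of polynomials.
-/
lemma weylD_mul_weylPolyX (i : σ) (p : MvPolynomial σ R) :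
    weylD R i * weylPolyX R σ p = weylPolyX R σ p * weylD R i + weylPolyX R σ (pderiv i p) := by
  classical
  induction p using MvPolynomial.induction_on with
  | C r => simp [← algebraMap_eq, Algebra.commutes]
  | add p q hp hq => simp only [map_add, mul_add, add_mul, hp, hq]; abel
  | mul_X p j hp =>
    rw [map_mul, ← mul_assoc, hp, Derivation.leibniz, map_add, smul_eq_mul, smul_eq_mul, map_mul,
      map_mul, pderiv_X, weylPolyX_X, add_mul, mul_assoc]
    by_cases h : i = j
    · subst h
      rw [weylD_mul_weylX_self]
      rw [← weylPolyX_X, ← map_mul (weylPolyX R σ) (X i), mul_comm (X i) (pderiv i p)]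
      simp [mul_add, mul_assoc, add_assoc]
    · rw [weylD_mul_weylX_of_ne R h]
      rw [← weylPolyX_X, ← map_mul (weylPolyX R σ) (X j) (pderiv i p), mul_comm (X j) (pderiv i p)]
      simp [h, mul_assoc]

/-- Normal ordering: the Weyl algebra is spanned by the products `p(x) q(∂)`. -/
lemma mem_span_weylPolyX_mul_weylPolyD (w : WeylAlgebra R σ) :
    w ∈ Submodule.span R (Set.range fun b : MvPolynomial σ R × (σ →₀ ℕ) =>
      weylPolyX R σ b.1 * weylPolyD R σ (monomial b.2 1)) := by
  set S := Submodule.span R (Set.range fun b : MvPolynomial σ R × (σ →₀ ℕ) =>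
      weylPolyX R σ b.1 * weylPolyD R σ (monomial b.2 1)) with hS
  -- The span is shown to be stable under left multiplication by generators, hence a left ideal; it
  -- contains 1.
  have hgen : ∀ (g : σ ⊕ σ) (s : WeylAlgebra R σ), s ∈ S →
      RingQuot.mkAlgHom R (WeylRel R σ) (FreeAlgebra.ι R g) * s ∈ S := by
    intro g s hs
    induction hs using Submodule.span_induction with
    | mem s hs =>
      obtain ⟨⟨p, b⟩, rfl⟩ := hs
      rcases g with i | i
      · refine Submodule.subset_span ⟨(X i * p, b), ?_⟩
        simp only [map_mul, weylPolyX_X, mul_assoc]; rfl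
      · have h1 : weylD R i * (weylPolyX R σ p * weylPolyD R σ (monomial b 1)) =
            weylPolyX R σ p * weylPolyD R σ (monomial (Finsupp.single i 1 + b) 1) +
              weylPolyX R σ (pderiv i p) * weylPolyD R σ (monomial b 1) := by
          rw [← mul_assoc, weylD_mul_weylPolyX, add_mul, mul_assoc, ← weylPolyD_X, ← map_mul, X,
            monomial_mul, one_mul]
        exact h1 ▸ add_mem (Submodule.subset_span ⟨(p, _), rfl⟩)
          (Submodule.subset_span ⟨(pderiv i p, b), rfl⟩)
    | zero => simp
    | add u v _ _ hu hv => rw [mul_add]; exact add_mem hu hv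
    | smul c u _ hu => rw [mul_smul_comm]; exact Submodule.smul_mem _ _ hu
  have key : ∀ (t : FreeAlgebra R (σ ⊕ σ)) (s : WeylAlgebra R σ), s ∈ S →
      RingQuot.mkAlgHom R (WeylRel R σ) t * s ∈ S := by
    intro t
    induction t using FreeAlgebra.induction with
    | grade0 r =>
      intro s hs
      rw [AlgHom.commutes, ← Algebra.smul_def]; exact Submodule.smul_mem _ _ hs
    | grade1 g => exact hgen g
    | mul a b ha hb => intro s hs; rw [map_mul, mul_assoc]; exact ha _ (hb _ hs)
    | add a b ha hb => intro s hs; rw [map_add, add_mul]; exact add_mem (ha _ hs) (hb _ hs)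
  obtain ⟨t, rfl⟩ := RingQuot.mkAlgHom_surjective R (WeylRel R σ) w
  have h1 : (1 : WeylAlgebra R σ) ∈ S :=
    Submodule.subset_span ⟨(1, 0), by simp [← MvPolynomial.C_apply]⟩
  simpa using key t 1 h1

lemma weylMatrixAction_tmul (V : Type*) [AddCommGroup V] [Module R V] (w : WeylAlgebra R σ)
    (B : Module.End R V) (p : MvPolynomial σ R) (v : V) :
    weylMatrixAction R σ V (w ⊗ₜ B) (p ⊗ₜ v) = weylAction R σ w p ⊗ₜ B v := by
  simp [weylMatrixAction, Module.endTensorEndAlgHom_apply]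

end Ring

/-! ### Faithfulness by triangularity -/

section Field

variable (K : Type*) [Field K] {σ : Type*}

open Classical in
variable {K} in
/-- Naturality of coefficients of polynomials with coefficients in a module. -/
lemma equivFinsupp_lTensor {M N : Type*} [AddCommGroup M] [Module K M] [AddCommGroup N]
    [Module K N] (g : M →ₗ[K] N) (t : MvPolynomial σ K ⊗[K] M) (a : σ →₀ ℕ) :
    TensorProduct.equivFinsuppOfBasisLeft (basisMonomials σ K) (g.lTensor _ t) a =
      g (TensorProduct.equivFinsuppOfBasisLeft (basisMonomials σ K) t a) := by
  induction t using TensorProduct.induction_on with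
  | zero => simp
  | tmul p m => simp
  | add s t hs ht => simp only [map_add, Finsupp.add_apply, hs, ht]

variable (V : Type*) [AddCommGroup V] [Module K V]

variable (σ) in
/-- The elements `∑ f b ∂ ^ b` of the Weyl algebra with matrix coefficients. -/
def weylNormalOrder : ((σ →₀ ℕ) →₀ MvPolynomial σ K ⊗[K] Module.End K V) →ₗ[K]
    WeylAlgebra K σ ⊗[K] Module.End K V :=
  Finsupp.lsum K fun b => LinearMap.mulRight K (weylPolyD K σ (monomial b 1) ⊗ₜ 1) ∘ₗ
    (weylPolyX K σ).toLinearMap.rTensor _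

lemma weylNormalOrder_surjective : Function.Surjective (weylNormalOrder K σ V) := by
  rw [← LinearMap.range_eq_top, eq_top_iff]
  rintro z -
  induction z using TensorProduct.induction_on with
  | zero => exact zero_mem _
  | add s t hs ht => exact add_mem hs ht
  | tmul w B =>
    induction mem_span_weylPolyX_mul_weylPolyD K w using Submodule.span_induction with
    | mem w hw =>
      obtain ⟨⟨p, b⟩, rfl⟩ := hw
      exact ⟨Finsupp.single b (p ⊗ₜ B), by simp [weylNormalOrder]⟩
    | zero => rw [TensorProduct.zero_tmul]; exact zero_mem _
    | add u v _ _ hu hv => rw [TensorProduct.add_tmul]; exact add_mem hu hv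
    | smul c u _ hu => rw [← TensorProduct.smul_tmul']; exact Submodule.smul_mem _ _ hu

lemma weylMatrixAction_weylNormalOrder
    (f : (σ →₀ ℕ) →₀ MvPolynomial σ K ⊗[K] Module.End K V) (p : MvPolynomial σ K) (v : V) :
    weylMatrixAction K σ V (weylNormalOrder K σ V f) (p ⊗ₜ v) =
      f.sum fun b t => (LinearMap.mulLeft K
        (weylAction K σ (weylPolyD K σ (monomial b 1)) p)).rTensor V
          ((LinearMap.applyₗ v : Module.End K V →ₗ[K] V).lTensor _ t) := by
  rw [weylNormalOrder, Finsupp.lsum_apply, map_finsuppSum, Finsupp.sum, Finsupp.sum,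
    LinearMap.sum_apply]
  refine Finset.sum_congr rfl fun b _ => ?_
  generalize f b = t
  induction t using TensorProduct.induction_on with
  | zero => simp
  | tmul q B =>
    simp [weylMatrixAction_tmul, weylAction_weylPolyX, mul_comm q]
  | add s t hs ht => simp only [map_add, LinearMap.add_apply, hs, ht]

variable [CharZero K]

/-- Only the vanishing pattern of the scalar is needed: ∂^b kills x^c exactly when b ≤ c fails. -/
lemma exists_weylAction_weylPolyD (b c : σ →₀ ℕ) :
    ∃ k : K, weylAction K σ (weylPolyD K σ (monomial b 1)) (monomial c 1) = monomial (c - b) k ∧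
      (k ≠ 0 ↔ b ≤ c) := by
  classical
  induction b using exponent_induction generalizing c with
  | zero => exact ⟨1, by simp [← MvPolynomial.C_apply], by simp⟩
  | add_single b j ih =>
    obtain ⟨k, hk, hk0⟩ := ih (c - Finsupp.single j 1)
    -- The factor c_j comes from differentiating once in x_j; it vanishes exactly when the
    -- subtraction from c_j is truncated.
    refine ⟨c j * k, ?_, ?_⟩
    · have hm : monomial (b + Finsupp.single j 1) (1 : K) = monomial b 1 * X j := by
        rw [X, monomial_mul, one_mul]
      have hc : monomial (c - Finsupp.single j 1) (c j : K) =
          (c j : K) • monomial (c - Finsupp.single j 1) 1 := by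
        rw [smul_monomial, smul_eq_mul, mul_one]
      rw [hm, map_mul, map_mul, weylPolyD_X, weylAction_weylD, Module.End.mul_apply,
        show (pderiv j).toLinearMap (monomial c (1 : K)) = pderiv j (monomial c 1) from rfl,
        pderiv_monomial, one_mul, hc, map_smul,
        hk, smul_monomial, smul_eq_mul, tsub_tsub, add_comm b]
    · rw [mul_ne_zero_iff, hk0, Nat.cast_ne_zero]
      constructor
      · rintro ⟨h1, h2⟩ i
        have := h2 i
        simp only [Finsupp.coe_tsub, Pi.sub_apply, Finsupp.coe_add, Pi.add_apply,
          Finsupp.single_apply] at this ⊢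
        split_ifs at this ⊢ with h
        · subst h; omega
        · omega
      · intro h
        have hj := h j
        simp only [Finsupp.coe_add, Pi.add_apply, Finsupp.single_eq_same] at hj
        exact ⟨by omega, le_tsub_of_add_le_right h⟩

variable (σ) in
/-- In characteristic zero, the Weyl algebra with matrix coefficients acts faithfully. -/
theorem weylMatrixAction_injective : Function.Injective (weylMatrixAction K σ V) := by
  classical
  rw [injective_iff_map_eq_zero]
  intro z hz
  obtain ⟨f, rfl⟩ := weylNormalOrder_surjective K V z
  suffices h : f = 0 by rw [h, map_zero]
  ext1 c
  induction c using WellFoundedLT.induction with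
  | ind c ih =>
    rw [Finsupp.zero_apply]
    obtain ⟨k, hk, hk0⟩ := exists_weylAction_weylPolyD K c c
    rw [tsub_self] at hk
    -- On x^c ⊗ v, terms with b < c vanish by induction and terms with b not below c kill x^c, so
    -- only a nonzero multiple of the c-th coefficient applied to v remains.
    have hv : ∀ v : V, (LinearMap.applyₗ v : Module.End K V →ₗ[K] V).lTensor
        (MvPolynomial σ K) (f c) = 0 := by
      intro v
      have h := weylMatrixAction_weylNormalOrder K V f (monomial c 1) v
      rw [hz, LinearMap.zero_apply, Finsupp.sum_eq_single c] at h
      · rw [hk, ← mul_one k, ← smul_eq_mul, ← smul_monomial, ← MvPolynomial.C_apply, C_1] at h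
        have h1 : LinearMap.mulLeft K (k • (1 : MvPolynomial σ K)) = k • LinearMap.id := by
          ext; simp
        rw [h1, LinearMap.rTensor_smul, LinearMap.rTensor_id, LinearMap.smul_apply,
          LinearMap.id_apply] at h
        exact (smul_eq_zero.1 h.symm).resolve_left (hk0.2 le_rfl)
      · intro b _ hbc
        by_cases hlt : b ≤ c
        · rw [ih b (lt_of_le_of_ne hlt hbc)]; simp
        · obtain ⟨k, hk, hk0⟩ := exists_weylAction_weylPolyD K b c
          have : k = 0 := by_contra fun h => hlt (hk0.1 h)
          rw [hk, this]; simp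
      · intro _; simp
    -- Viewed as a polynomial with coefficients in End V, `f c` has each coefficient killing every
    -- v. No finiteness of V is involved.
    apply (TensorProduct.equivFinsuppOfBasisLeft (basisMonomials σ K)).injective
    ext a v
    have := equivFinsupp_lTensor (LinearMap.applyₗ v : Module.End K V →ₗ[K] V) (f c) a
    rw [hv v] at this
    simpa using this.symm

end Field

end WeylFaithful

end

noncomputable section

/-! ### The basis of an induced module -/

section InducedBasis

open UniversalEnvelopingAlgebra

section Basic

variable {R : Type*} [CommRing R] {L : Type*} [LieRing L] [LieAlgebra R L]
  (𝔭 : LieSubalgebra R L)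

lemma envelopingIncl_ι (z : 𝔭) : envelopingIncl 𝔭 (ι R z) = ι R (z : L) :=
  lift_ι_apply R _ z

lemma envelopingIncl_orderedMonomial {m : ℕ} (e : Fin m → 𝔭) (b : Fin m →₀ ℕ) :
    envelopingIncl 𝔭 (orderedMonomial e b) = orderedMonomial (fun j => (e j : L)) b := by
  simp [-UniversalEnvelopingAlgebra.ι_apply, orderedMonomial, map_list_prod, List.map_ofFn,
    Function.comp_def, envelopingIncl_ι]

variable {V : Type*} [AddCommGroup V] [Module R V] [LieRingModule 𝔭 V] [LieModule R 𝔭 V]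

lemma envelopingAction_ι (z : 𝔭) (v : V) : envelopingAction 𝔭 V (ι R z) v = ⁅z, v⁆ :=
  LinearMap.congr_fun (lift_ι_apply R _ z) v

lemma GenVerma.tmul_mul (a : UniversalEnvelopingAlgebra R L) (w : UniversalEnvelopingAlgebra R 𝔭)
    (v : V) : GenVerma.tmul 𝔭 (a * envelopingIncl 𝔭 w) v =
      GenVerma.tmul 𝔭 a (envelopingAction 𝔭 V w v) :=
  (Submodule.Quotient.eq _).2 (Submodule.subset_span ⟨a, w, v, rfl⟩)

variable (V) in
/-- The quotient map onto the induced module, linear over the base ring. -/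
def GenVerma.mk : UniversalEnvelopingAlgebra R L ⊗[R] V →ₗ[R] GenVerma 𝔭 V :=
  (balancingRelations 𝔭 V).mkQ.restrictScalars R

lemma GenVerma.mk_tmul (a : UniversalEnvelopingAlgebra R L) (v : V) :
    GenVerma.mk 𝔭 V (a ⊗ₜ v) = GenVerma.tmul 𝔭 a v := rfl

lemma GenVerma.mk_surjective : Function.Surjective (GenVerma.mk 𝔭 V) :=
  (balancingRelations 𝔭 V).mkQ_surjective

lemma GenVerma.hom_ext {M : Type*} [AddCommGroup M] [Module R M] {f g : GenVerma 𝔭 V →ₗ[R] M}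
    (h : ∀ a v, f (GenVerma.tmul 𝔭 a v) = g (GenVerma.tmul 𝔭 a v)) : f = g := by
  have h' : f ∘ₗ GenVerma.mk 𝔭 V = g ∘ₗ GenVerma.mk 𝔭 V := TensorProduct.ext' h
  refine LinearMap.ext fun x => ?_
  obtain ⟨t, rfl⟩ := GenVerma.mk_surjective 𝔭 x
  exact LinearMap.congr_fun h' t

variable (V) in
/-- A linear map which is balanced over the subalgebra descends to the induced module. -/
def GenVerma.lift {M : Type*} [AddCommGroup M] [Module R M]
    (f : UniversalEnvelopingAlgebra R L ⊗[R] V →ₗ[R] M)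
    (h : ∀ a w v, f ((a * envelopingIncl 𝔭 w) ⊗ₜ v) = f (a ⊗ₜ envelopingAction 𝔭 V w v)) :
    GenVerma 𝔭 V →ₗ[R] M :=
  ((balancingRelations 𝔭 V).restrictScalars R).liftQ f (by
    intro t ht
    -- The relations span over U(L) while f is only R-linear, so the claim is strengthened to all
    -- multiples of t.
    have key : ∀ t ∈ balancingRelations 𝔭 V, ∀ x : UniversalEnvelopingAlgebra R L,
        f (x • t) = 0 := by
      intro t ht
      induction ht using Submodule.span_induction with
      | mem t ht =>
        obtain ⟨a, w, v, rfl⟩ := ht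
        intro x
        rw [smul_sub, TensorProduct.smul_tmul', TensorProduct.smul_tmul', map_sub, smul_eq_mul,
          smul_eq_mul, ← mul_assoc, h, sub_self]
      | zero => simp
      | add s t _ _ hs ht => intro x; rw [smul_add, map_add, hs, ht, add_zero]
      | smul y t _ ht => intro x; rw [smul_smul, ht]
    simpa using key t ht 1) ∘ₗ
    (Submodule.Quotient.restrictScalarsEquiv R (balancingRelations 𝔭 V)).symm.toLinearMap

lemma GenVerma.lift_tmul {M : Type*} [AddCommGroup M] [Module R M]
    (f : UniversalEnvelopingAlgebra R L ⊗[R] V →ₗ[R] M)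
    (h : ∀ a w v, f ((a * envelopingIncl 𝔭 w) ⊗ₜ v) = f (a ⊗ₜ envelopingAction 𝔭 V w v))
    (a : UniversalEnvelopingAlgebra R L) (v : V) :
    GenVerma.lift 𝔭 V f h (GenVerma.tmul 𝔭 a v) = f (a ⊗ₜ v) := rfl

end Basic

/-! ### Coordinates on the induced module from an adapted PBW basis -/

section Basis

variable {K : Type*} [Field K] {L : Type*} [LieRing L] [LieAlgebra K L]
  (𝔭 : LieSubalgebra K L)

/-- Concatenation of exponents. -/
def appendExponent {n m : ℕ} (a : Fin n →₀ ℕ) (b : Fin m →₀ ℕ) : Fin (n + m) →₀ ℕ :=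
  Finsupp.equivFunOnFinite.symm (Fin.append a b)

lemma appendExponent_comapDomain {n m : ℕ} (c : Fin (n + m) →₀ ℕ) :
    appendExponent (c.comapDomain (Fin.castAdd m) (Fin.castAdd_injective n m).injOn)
      (c.comapDomain (Fin.natAdd n) (Fin.natAdd_injective m n).injOn) = c := by
  ext i
  refine Fin.addCases (fun i => ?_) (fun i => ?_) i <;> simp [appendExponent]

lemma comapDomain_castAdd_appendExponent {n m : ℕ} (a : Fin n →₀ ℕ) (b : Fin m →₀ ℕ) :
    (appendExponent a b).comapDomain (Fin.castAdd m) (Fin.castAdd_injective n m).injOn = a := by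
  ext i; simp [appendExponent]

lemma comapDomain_natAdd_appendExponent {n m : ℕ} (a : Fin n →₀ ℕ) (b : Fin m →₀ ℕ) :
    (appendExponent a b).comapDomain (Fin.natAdd n) (Fin.natAdd_injective m n).injOn = b := by
  ext i; simp [appendExponent]

lemma orderedMonomial_append {R L : Type*} [CommRing R] [LieRing L] [LieAlgebra R L] {n m : ℕ}
    (u : Fin n → L) (p : Fin m → L) (a : Fin n →₀ ℕ) (b : Fin m →₀ ℕ) :
    (orderedMonomial (Fin.append u p) (appendExponent a b) : UniversalEnvelopingAlgebra R L) =
      orderedMonomial u a * orderedMonomial p b := by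
  simp [orderedMonomial, appendExponent, List.ofFn_add]

variable (V : Type*) [AddCommGroup V] [Module K V] [LieRingModule 𝔭 V] [LieModule K 𝔭 V]
  {n m : ℕ} {u : Fin n → L} (p : Module.Basis (Fin m) K 𝔭)
  (e : Module.Basis (Fin (n + m)) K L)

variable {p e} in
lemma polyToEnv_monomial_append (he : ⇑e = Fin.append u fun j => (p j : L))
    (a : Fin n →₀ ℕ) (b : Fin m →₀ ℕ) :
    polyToEnv (R := K) e (MvPolynomial.monomial (appendExponent a b) 1) =
      orderedMonomial u a * envelopingIncl 𝔭 (orderedMonomial p b) := by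
  rw [envelopingIncl_orderedMonomial, ← orderedMonomial_append, ← he, ← polyToEnv_monomial]

variable {p e} in
lemma mem_span_orderedMonomial_mul (he : ⇑e = Fin.append u fun j => (p j : L))
    (x : UniversalEnvelopingAlgebra K L) :
    x ∈ Submodule.span K (Set.range fun c : (Fin n →₀ ℕ) × UniversalEnvelopingAlgebra K 𝔭 =>
      orderedMonomial u c.1 * envelopingIncl 𝔭 c.2) := by
  obtain ⟨f, rfl⟩ := polyToEnv_surjective (R := K) e e.span_eq x
  have := Submodule.mem_map_of_mem (f := polyToEnv (R := K) e)
    ((MvPolynomial.basisMonomials (Fin (n + m)) K).mem_span f)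
  rw [Submodule.map_span] at this
  refine Submodule.span_mono ?_ this
  rintro _ ⟨_, ⟨c, rfl⟩, rfl⟩
  refine ⟨⟨_, _⟩, ((polyToEnv_monomial_append 𝔭 he
    (c.comapDomain (Fin.castAdd m) (Fin.castAdd_injective n m).injOn)
      (c.comapDomain (Fin.natAdd n) (Fin.natAdd_injective m n).injOn))).symm.trans ?_⟩
  rw [appendExponent_comapDomain, MvPolynomial.coe_basisMonomials]

variable (u) in
/-- The map `x ^ a ⊗ v ↦ u ^ a ⊗ v` from polynomials with coefficients in `V` to the induced
module. -/
def polyToGenVerma : MvPolynomial (Fin n) K ⊗[K] V →ₗ[K] GenVerma 𝔭 V :=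
  GenVerma.mk 𝔭 V ∘ₗ (polyToEnv u).rTensor V

lemma polyToGenVerma_monomial (a : Fin n →₀ ℕ) (v : V) :
    polyToGenVerma 𝔭 V u (MvPolynomial.monomial a 1 ⊗ₜ v) =
      GenVerma.tmul 𝔭 (orderedMonomial u a) v := by
  simp [polyToGenVerma, polyToEnv_monomial, GenVerma.mk_tmul]

variable [CharZero K] (hι : Function.Injective (ι K : L → UniversalEnvelopingAlgebra K L))

/-- The linear map `u ^ a * p ^ b ⊗ v ↦ x ^ a ⊗ (p ^ b) v`. -/
def pbwCoordinates : UniversalEnvelopingAlgebra K L ⊗[K] V →ₗ[K] MvPolynomial (Fin n) K ⊗[K] V :=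
  TensorProduct.lift ((MvPolynomial.basisMonomials (Fin (n + m)) K).constr K (fun c =>
    TensorProduct.mk K (MvPolynomial (Fin n) K) V (MvPolynomial.monomial
      (c.comapDomain (Fin.castAdd m) (Fin.castAdd_injective n m).injOn) 1) ∘ₗ
    envelopingAction 𝔭 V (orderedMonomial p
      (c.comapDomain (Fin.natAdd n) (Fin.natAdd_injective m n).injOn))) ∘ₗ
    (pbwEquiv e hι).symm.toLinearMap)

variable {p e} in
-- This frees the defining formula from the chosen basis of 𝔭: the right factor may be any element
-- of U(𝔭).
lemma pbwCoordinates_tmul (he : ⇑e = Fin.append u fun j => (p j : L)) (a : Fin n →₀ ℕ)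
    (w : UniversalEnvelopingAlgebra K 𝔭) (v : V) :
    pbwCoordinates 𝔭 V p e hι ((orderedMonomial u a * envelopingIncl 𝔭 w) ⊗ₜ v) =
      MvPolynomial.monomial a 1 ⊗ₜ envelopingAction 𝔭 V w v := by
  -- For 𝔭 only spanning is used; independence of ordered monomials enters for L alone.
  obtain ⟨g, rfl⟩ := polyToEnv_surjective p p.span_eq w
  have : pbwCoordinates 𝔭 V p e hι ∘ₗ (TensorProduct.mk K _ V).flip v ∘ₗ
      LinearMap.mulLeft K (orderedMonomial u a) ∘ₗ (envelopingIncl 𝔭).toLinearMap ∘ₗ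
        polyToEnv p = TensorProduct.mk K _ V (MvPolynomial.monomial a 1) ∘ₗ
          LinearMap.applyₗ v ∘ₗ (envelopingAction 𝔭 V).toLinearMap ∘ₗ polyToEnv p := by
    refine (MvPolynomial.basisMonomials (Fin m) K).ext fun b => ?_
    rw [MvPolynomial.coe_basisMonomials]
    simp only [LinearMap.comp_apply, AlgHom.toLinearMap_apply, polyToEnv_monomial,
      LinearMap.mulLeft_apply, LinearMap.flip_apply, TensorProduct.mk_apply]
    rw [← polyToEnv_monomial_append 𝔭 he, ← pbwEquiv_apply e hι, pbwCoordinates, TensorProduct.lift.tmul,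
      LinearMap.comp_apply, LinearEquiv.coe_coe, LinearEquiv.symm_apply_apply,
      show MvPolynomial.monomial (appendExponent a b) (1 : K) =
        MvPolynomial.basisMonomials _ K (appendExponent a b) by simp,
      Module.Basis.constr_basis, comapDomain_castAdd_appendExponent,
      comapDomain_natAdd_appendExponent]
    rfl
  exact LinearMap.congr_fun this g

variable {p e} in
-- On the spanning elements u^a w' the map applies w' to the vector, and the action of U(𝔭) is
-- multiplicative.
lemma pbwCoordinates_balanced (he : ⇑e = Fin.append u fun j => (p j : L))
    (a : UniversalEnvelopingAlgebra K L) (w : UniversalEnvelopingAlgebra K 𝔭) (v : V) :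
    pbwCoordinates 𝔭 V p e hι ((a * envelopingIncl 𝔭 w) ⊗ₜ v) =
      pbwCoordinates 𝔭 V p e hι (a ⊗ₜ envelopingAction 𝔭 V w v) := by
  induction mem_span_orderedMonomial_mul 𝔭 he a using Submodule.span_induction with
  | mem a ha =>
    obtain ⟨⟨a, w'⟩, rfl⟩ := ha
    simp only
    rw [mul_assoc, ← map_mul, pbwCoordinates_tmul 𝔭 V hι he, pbwCoordinates_tmul 𝔭 V hι he,
      map_mul, Module.End.mul_apply]
  | zero => simp
  | add a b _ _ ha hb => simp only [add_mul, TensorProduct.add_tmul, map_add, ha, hb]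
  | smul c a _ ha => simp only [smul_mul_assoc, ← TensorProduct.smul_tmul', map_smul, ha]

variable {p e} in
/-- An induced module is free over the monomials in a basis of a complement of the subalgebra. -/
def genVermaEquiv (he : ⇑e = Fin.append u fun j => (p j : L)) :
    GenVerma 𝔭 V ≃ₗ[K] MvPolynomial (Fin n) K ⊗[K] V :=
  LinearEquiv.ofLinearMap
    (GenVerma.lift 𝔭 V (pbwCoordinates 𝔭 V p e hι) (pbwCoordinates_balanced 𝔭 V hι he))
    (polyToGenVerma 𝔭 V u)
    (by
      refine TensorProduct.ext ((MvPolynomial.basisMonomials (Fin n) K).ext fun a =>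
        LinearMap.ext fun v => ?_)
      rw [MvPolynomial.coe_basisMonomials]
      change GenVerma.lift 𝔭 V (pbwCoordinates 𝔭 V p e hι) (pbwCoordinates_balanced 𝔭 V hι he)
        (polyToGenVerma 𝔭 V u (MvPolynomial.monomial a 1 ⊗ₜ v)) = MvPolynomial.monomial a 1 ⊗ₜ v
      rw [polyToGenVerma_monomial, GenVerma.lift_tmul]
      simpa using pbwCoordinates_tmul 𝔭 V hι he a 1 v)
    (by
      refine GenVerma.hom_ext 𝔭 fun x v => ?_
      rw [LinearMap.comp_apply, GenVerma.lift_tmul, LinearMap.id_apply, ← GenVerma.mk_tmul]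
      induction mem_span_orderedMonomial_mul 𝔭 he x using Submodule.span_induction with
      | mem x hx =>
        obtain ⟨⟨a, w⟩, rfl⟩ := hx
        simp only
        rw [pbwCoordinates_tmul 𝔭 V hι he, polyToGenVerma_monomial, GenVerma.mk_tmul,
          GenVerma.tmul_mul]
      | zero => simp
      | add a b _ _ ha hb => simp only [TensorProduct.add_tmul, map_add, ha, hb]
      | smul c a _ ha => simp only [← TensorProduct.smul_tmul', map_smul, ha])

variable {p e} in
lemma genVermaEquiv_tmul (he : ⇑e = Fin.append u fun j => (p j : L)) (a : Fin n →₀ ℕ) (v : V) :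
    genVermaEquiv 𝔭 V hι he (GenVerma.tmul 𝔭 (orderedMonomial u a) v) =
      MvPolynomial.monomial a 1 ⊗ₜ v := by
  change GenVerma.lift 𝔭 V (pbwCoordinates 𝔭 V p e hι) (pbwCoordinates_balanced 𝔭 V hι he) _ = _
  rw [GenVerma.lift_tmul]
  simpa using pbwCoordinates_tmul 𝔭 V hι he a 1 v

end Basis

end InducedBasis

end

noncomputable section

/-! ### The action on an induced module by differential operators -/

section Insertion

open UniversalEnvelopingAlgebra MvPolynomial

/-- Right multiplication by x is left multiplication plus -ad x, and the two commute, so the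
binomial theorem applies. -/
lemma mul_pow_eq_sum_choose {R A : Type*} [CommRing R] [Ring A] [Algebra R A] (x y : A) (m : ℕ) :
    y * x ^ m = ∑ k ∈ Finset.range (m + 1), (m.choose k : R) •
      (x ^ (m - k) * ((LinearMap.mulRight R x - LinearMap.mulLeft R x) ^ k) y) := by
  have hc : Commute (LinearMap.mulRight R x - LinearMap.mulLeft R x) (LinearMap.mulLeft R x) :=
    (LinearMap.commute_mulLeft_right x x).symm.sub_left (Commute.refl _)
  have h := hc.add_pow m
  rw [sub_add_cancel, LinearMap.pow_mulRight] at h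
  rw [← LinearMap.mulRight_apply R, h, LinearMap.sum_apply]
  refine Finset.sum_congr rfl fun k _ => ?_
  rw [(hc.pow_pow _ _).eq, ← nsmul_eq_mul', LinearMap.smul_apply, Module.End.mul_apply,
    LinearMap.pow_mulLeft, LinearMap.mulLeft_apply, Nat.cast_smul_eq_nsmul]

/-! ### Divided powers of the derivations -/

section Divided

variable (K : Type*) [Field K] {σ : Type*}

/-- The divided powers of the derivations in the Weyl algebra. -/
def weylDividedD (j : σ) (k : ℕ) : WeylAlgebra K σ := (k.factorial : K)⁻¹ • weylD K j ^ k

lemma weylDividedD_zero (j : σ) : weylDividedD K j 0 = 1 := by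
  simp [weylDividedD]

lemma weylAction_weylD_pow_monomial (j : σ) (k : ℕ) (a : σ →₀ ℕ) :
    weylAction K σ (weylD K j ^ k) (monomial a 1) =
      ((a j).descFactorial k : K) • monomial (a - Finsupp.single j k) 1 := by
  induction k with
  | zero => simp
  | succ k ih =>
    rw [pow_succ', map_mul, Module.End.mul_apply, ih, map_smul, weylAction_weylD,
      show ∀ f : MvPolynomial σ K, (pderiv j).toLinearMap f = pderiv j f from fun _ => rfl,
      pderiv_monomial, one_mul, tsub_tsub, ← Finsupp.single_add, Nat.descFactorial_succ,
      smul_monomial, smul_monomial]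
    simp [mul_comm]

variable [CharZero K]

/-- Dividing by k! turns the falling factorial into the binomial coefficient of the moving rule. -/
lemma weylAction_weylDividedD_monomial (j : σ) (k : ℕ) (a : σ →₀ ℕ) :
    weylAction K σ (weylDividedD K j k) (monomial a 1) =
      ((a j).choose k : K) • monomial (a - Finsupp.single j k) 1 := by
  have hk : (k.factorial : K) ≠ 0 := by exact_mod_cast k.factorial_ne_zero
  rw [weylDividedD, map_smul, LinearMap.smul_apply, weylAction_weylD_pow_monomial, smul_smul,
    Nat.descFactorial_eq_factorial_mul_choose, Nat.cast_mul, inv_mul_cancel_left₀ hk]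

end Divided

/-! ### Inserting an element inside an ordered monomial -/

section Insert

variable (R : Type*) [CommRing R] {L : Type*} [LieRing L] [LieAlgebra R L] {n : ℕ}

/-- The product of the first `j` factors of an ordered monomial. -/
def monomialTake (u : Fin n → L) (j : ℕ) (a : Fin n →₀ ℕ) : UniversalEnvelopingAlgebra R L :=
  ((List.ofFn fun i => ι R (u i) ^ a i).take j).prod

/-- The product of all but the first `j` factors of an ordered monomial. -/
def monomialDrop (u : Fin n → L) (j : ℕ) (a : Fin n →₀ ℕ) : UniversalEnvelopingAlgebra R L :=
  ((List.ofFn fun i => ι R (u i) ^ a i).drop j).prod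

lemma monomialTake_mul_monomialDrop (u : Fin n → L) (j : ℕ) (a : Fin n →₀ ℕ) :
    monomialTake R u j a * monomialDrop R u j a = orderedMonomial u a :=
  List.prod_take_mul_prod_drop _ _

lemma monomialTake_succ (u : Fin n → L) (j : Fin n) (a : Fin n →₀ ℕ) :
    monomialTake R u (j + 1) a = monomialTake R u j a * ι R (u j) ^ a j := by
  rw [monomialTake, List.prod_take_succ _ _ (by simp)]
  simp [monomialTake]

lemma monomialDrop_eq (u : Fin n → L) (j : Fin n) (a : Fin n →₀ ℕ) :
    monomialDrop R u j a = ι R (u j) ^ a j * monomialDrop R u (j + 1) a := by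
  rw [monomialDrop, List.drop_eq_getElem_cons (by simp), List.prod_cons]
  simp [monomialDrop]

lemma monomialTake_congr (u : Fin n → L) (j : ℕ) {a b : Fin n →₀ ℕ}
    (h : ∀ i : Fin n, (i : ℕ) < j → a i = b i) : monomialTake R u j a = monomialTake R u j b := by
  rw [monomialTake, monomialTake]
  congr 1
  refine List.ext_getElem (by simp) fun i h1 h2 => ?_
  simp only [List.length_take, List.length_ofFn, lt_inf_iff] at h1
  simp only [List.getElem_take, List.getElem_ofFn]
  rw [h ⟨i, h1.2⟩ h1.1]

lemma monomialDrop_congr (u : Fin n → L) (j : ℕ) {a b : Fin n →₀ ℕ}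
    (h : ∀ i : Fin n, j ≤ (i : ℕ) → a i = b i) : monomialDrop R u j a = monomialDrop R u j b := by
  rw [monomialDrop, monomialDrop]
  congr 1
  refine List.ext_getElem (by simp) fun i h1 h2 => ?_
  simp only [List.getElem_drop, List.getElem_ofFn]
  rw [h ⟨j + i, _⟩ (Nat.le_add_right _ _)]

/-- The linear map inserting an element of the enveloping algebra after the first `j` factors of
an ordered monomial. -/
def insertMap (u : Fin n → L) (j : ℕ) : UniversalEnvelopingAlgebra R L →ₗ[R]
    MvPolynomial (Fin n) R →ₗ[R] UniversalEnvelopingAlgebra R L :=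
  ((basisMonomials (Fin n) R).constr R).toLinearMap ∘ₗ LinearMap.pi fun a =>
    LinearMap.mulLeft R (monomialTake R u j a) ∘ₗ LinearMap.mulRight R (monomialDrop R u j a)

lemma insertMap_monomial (u : Fin n → L) (j : ℕ) (y : UniversalEnvelopingAlgebra R L)
    (a : Fin n →₀ ℕ) : insertMap R u j y (monomial a 1) =
      monomialTake R u j a * (y * monomialDrop R u j a) := by
  rw [show monomial a (1 : R) = basisMonomials (Fin n) R a by simp, insertMap,
    LinearMap.comp_apply, LinearEquiv.coe_coe, Module.Basis.constr_basis]
  simp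

lemma insertMap_zero (u : Fin n → L) (y : UniversalEnvelopingAlgebra R L) :
    insertMap R u 0 y = LinearMap.mulLeft R y ∘ₗ polyToEnv u := by
  refine (basisMonomials (Fin n) R).ext fun a => ?_
  rw [coe_basisMonomials, insertMap_monomial, LinearMap.comp_apply, polyToEnv_monomial]
  simp [monomialTake, monomialDrop, orderedMonomial]

lemma insertMap_length_monomial (u : Fin n → L) (y : UniversalEnvelopingAlgebra R L)
    (a : Fin n →₀ ℕ) : insertMap R u n y (monomial a 1) = orderedMonomial u a * y := by
  have h : monomialDrop R u n a = 1 := by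
    rw [monomialDrop, List.drop_eq_nil_of_le (by simp), List.prod_nil]
  rw [insertMap_monomial, ← monomialTake_mul_monomialDrop R u n, h, mul_one, mul_one]

/-- Indices start at 0, so position i is just before the power of u_i, which absorbs the inserted
factor without any reordering. -/
lemma insertMap_self (u : Fin n → L) (i : Fin n) :
    insertMap R u i (ι R (u i)) = polyToEnv u ∘ₗ LinearMap.mulLeft R (X i) := by
  refine (basisMonomials (Fin n) R).ext fun a => ?_
  rw [coe_basisMonomials, insertMap_monomial, LinearMap.comp_apply, LinearMap.mulLeft_apply, X,
    monomial_mul, one_mul, polyToEnv_monomial, ← monomialTake_mul_monomialDrop R u i,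
    monomialDrop_eq, monomialDrop_eq, ← mul_assoc (ι R (u i)), ← pow_succ']
  have h1 : monomialTake R u i (Finsupp.single i 1 + a) = monomialTake R u i a := by
    refine monomialTake_congr R u _ fun l hl => ?_
    have : i ≠ l := fun h => by subst h; exact lt_irrefl _ hl
    simp [this]
  have h2 : monomialDrop R u (i + 1) (Finsupp.single i 1 + a) = monomialDrop R u (i + 1) a := by
    refine monomialDrop_congr R u _ fun l hl => ?_
    have : i ≠ l := fun h => by subst h; omega
    simp [this]
  rw [h1, h2, Finsupp.add_apply, Finsupp.single_eq_same, add_comm 1]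

end Insert

/-! ### Moving an inserted element past one factor -/

section Step

variable {K : Type*} [Field K] {L : Type*} [LieRing L] [LieAlgebra K L] {n : ℕ}

lemma mulRight_sub_mulLeft_pow_ι (x y : L) (k : ℕ) :
    ((LinearMap.mulRight K (ι K x) - LinearMap.mulLeft K (ι K x)) ^ k) (ι K y) =
      ι K (((-LieAlgebra.ad K L x) ^ k) y) := by
  induction k with
  | zero => rfl
  | succ k ih =>
    rw [pow_succ', pow_succ', Module.End.mul_apply, Module.End.mul_apply, ih, LinearMap.neg_apply,
      LieAlgebra.ad_apply, ← lie_skew, neg_neg, enveloping_ι_lie]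
    rfl

variable [CharZero K]

/-- The moving rule has a_j + 1 terms, depending on the monomial; nilpotency replaces this by the
fixed bound N, so one differential operator serves all monomials. -/
lemma insertMap_eq_sum (u : Fin n → L) (j : Fin n) (y : UniversalEnvelopingAlgebra K L) (N : ℕ)
    (hN : ((LinearMap.mulRight K (ι K (u j)) - LinearMap.mulLeft K (ι K (u j))) ^ N) y = 0) :
    insertMap K u j y = ∑ k ∈ Finset.range N, insertMap K u (j + 1)
      (((LinearMap.mulRight K (ι K (u j)) - LinearMap.mulLeft K (ι K (u j))) ^ k) y) ∘ₗ
        weylAction K (Fin n) (weylDividedD K j k) := by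
  set D := LinearMap.mulRight K (ι K (u j)) - LinearMap.mulLeft K (ι K (u j)) with hD
  refine (basisMonomials (Fin n) K).ext fun a => ?_
  rw [coe_basisMonomials, insertMap_monomial, monomialDrop_eq, ← mul_assoc y,
    mul_pow_eq_sum_choose (R := K), LinearMap.sum_apply, Finset.sum_mul, Finset.mul_sum]
  set F : ℕ → UniversalEnvelopingAlgebra K L := fun k => monomialTake K u j a *
    (((a j).choose k : K) • (ι K (u j) ^ (a j - k) * (D ^ k) y) * monomialDrop K u (j + 1) a)
    with hF
  have h1 : ∀ k, N ≤ k → F k = 0 := by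
    intro k hk
    have : (D ^ k) y = 0 := by
      rw [← Nat.sub_add_cancel hk, pow_add, Module.End.mul_apply, hN, map_zero]
    simp [hF, this]
  have h2 : ∀ k, a j + 1 ≤ k → F k = 0 := by
    intro k hk
    simp [hF, Nat.choose_eq_zero_of_lt (Nat.lt_of_succ_le hk)]
  -- Both sums equal the sum up to the larger bound: binomials vanish beyond a_j, powers of -ad
  -- vanish from N on.
  have h3 : ∑ k ∈ Finset.range (a j + 1), F k = ∑ k ∈ Finset.range N, F k := by
    exact (Finset.sum_subset (Finset.range_mono (le_max_left (a j + 1) N)) fun k _ hk =>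
        h2 k (by simpa using hk)).trans
      (Finset.sum_subset (Finset.range_mono (le_max_right (a j + 1) N)) fun k _ hk =>
        h1 k (by simpa using hk)).symm
  refine h3.trans (Finset.sum_congr rfl fun k _ => ?_)
  rw [LinearMap.comp_apply, weylAction_weylDividedD_monomial, map_smul, insertMap_monomial,
    monomialTake_succ, hF]
  have h4 : monomialTake K u j (a - Finsupp.single j k) = monomialTake K u j a := by
    refine monomialTake_congr K u _ fun l hl => ?_
    have : j ≠ l := fun h => by subst h; exact lt_irrefl _ hl
    simp [this]
  have h5 : monomialDrop K u (j + 1) (a - Finsupp.single j k) = monomialDrop K u (j + 1) a := by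
    refine monomialDrop_congr K u _ fun l hl => ?_
    have : j ≠ l := fun h => by subst h; omega
    simp [this]
  rw [h4, h5]
  simp only [Finsupp.coe_tsub, Pi.sub_apply, Finsupp.single_eq_same]
  rw [smul_mul_assoc, mul_smul_comm]
  simp only [mul_assoc]

end Step

end Insertion

end

noncomputable section

/-! ### Induced modules as modules of differential operators -/

section DifferentialOperators

open UniversalEnvelopingAlgebra MvPolynomial

variable {K : Type*} [Field K] {L : Type*} [LieRing L] [LieAlgebra K L]
  {𝔭 : LieSubalgebra K L} {V : Type*} [AddCommGroup V] [Module K V] [LieRingModule 𝔭 V]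
  [LieModule K 𝔭 V] {n : ℕ} (u : Fin n → L)

lemma rTensor_weylAction_mem_range (w : WeylAlgebra K (Fin n)) :
    (weylAction K (Fin n) w).rTensor V ∈ (weylMatrixAction K (Fin n) V).range :=
  ⟨w ⊗ₜ 1, TensorProduct.ext' fun p v => weylMatrixAction_tmul K V w 1 p v⟩

lemma lTensor_mem_range (B : Module.End K V) :
    B.lTensor (MvPolynomial (Fin n) K) ∈ (weylMatrixAction K (Fin n) V).range :=
  ⟨1 ⊗ₜ B, TensorProduct.ext' fun p v => by
    refine (weylMatrixAction_tmul K V 1 B p v).trans ?_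
    rw [map_one]; rfl⟩

variable (φ : GenVerma 𝔭 V ≃ₗ[K] MvPolynomial (Fin n) K ⊗[K] V)

/-- The operator on polynomials with coefficients in `V` which inserts an element of `L` after the
first `j` factors of the ordered monomials. -/
def insertionOperator (j : ℕ) : L →ₗ[K] Module.End K (MvPolynomial (Fin n) K ⊗[K] V) :=
  LinearMap.compRight K (φ.toLinearMap ∘ₗ GenVerma.mk 𝔭 V) ∘ₗ LinearMap.rTensorHom V ∘ₗ
    insertMap K u j ∘ₗ (mkAlgHom K L).toLinearMap ∘ₗ TensorAlgebra.ι K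

lemma insertionOperator_apply (j : ℕ) (y : L) : insertionOperator u φ j y =
    φ.toLinearMap ∘ₗ GenVerma.mk 𝔭 V ∘ₗ (insertMap K u j (ι K y)).rTensor V := rfl

variable {u φ}

lemma tensor_monomial_ext {M : Type*} [AddCommGroup M] [Module K M]
    {f g : MvPolynomial (Fin n) K ⊗[K] V →ₗ[K] M}
    (h : ∀ a v, f (monomial a 1 ⊗ₜ v) = g (monomial a 1 ⊗ₜ v)) : f = g :=
  TensorProduct.ext ((basisMonomials (Fin n) K).ext fun a => LinearMap.ext fun v => by
    simpa using h a v)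

lemma comp_polyToEnv
    (hφ : ∀ (a : Fin n →₀ ℕ) (v : V),
      φ (GenVerma.tmul 𝔭 (orderedMonomial u a) v) = monomial a 1 ⊗ₜ v) :
    φ.toLinearMap ∘ₗ GenVerma.mk 𝔭 V ∘ₗ (polyToEnv u).rTensor V =
    LinearMap.id :=
  tensor_monomial_ext fun a v => by
    simpa [polyToEnv_monomial, GenVerma.mk_tmul] using hφ a v

lemma insertionOperator_self_mem
    (hφ : ∀ (a : Fin n →₀ ℕ) (v : V),
      φ (GenVerma.tmul 𝔭 (orderedMonomial u a) v) = monomial a 1 ⊗ₜ v)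
    (i : Fin n) :
    insertionOperator u φ i (u i) ∈ (weylMatrixAction K (Fin n) V).range := by
  have h : insertionOperator u φ i (u i) = (weylAction K (Fin n) (weylX K i)).rTensor V := by
    rw [insertionOperator_apply, insertMap_self, LinearMap.rTensor_comp, weylAction_weylX]
    exact LinearMap.ext fun t => LinearMap.congr_fun (comp_polyToEnv hφ) _
  exact h ▸ rTensor_weylAction_mem_range _

/-- At the right end an element of 𝔭 crosses the tensor sign and acts on V alone. -/
lemma insertionOperator_length_mem
    (hφ : ∀ (a : Fin n →₀ ℕ) (v : V),
      φ (GenVerma.tmul 𝔭 (orderedMonomial u a) v) = monomial a 1 ⊗ₜ v)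
    (z : 𝔭) :
    insertionOperator u φ n (z : L) ∈ (weylMatrixAction K (Fin n) V).range := by
  have h : insertionOperator u φ n (z : L) =
      (LieModule.toEnd K 𝔭 V z).lTensor (MvPolynomial (Fin n) K) :=
    tensor_monomial_ext fun a v => by
      rw [insertionOperator_apply, LinearMap.comp_apply, LinearMap.comp_apply,
        LinearMap.rTensor_tmul, insertMap_length_monomial, GenVerma.mk_tmul, ← envelopingIncl_ι,
        GenVerma.tmul_mul, envelopingAction_ι]
      exact hφ a _
  exact h ▸ lTensor_mem_range _

lemma insertionOperator_zero
    (hφ : ∀ (a : Fin n →₀ ℕ) (v : V),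
      φ (GenVerma.tmul 𝔭 (orderedMonomial u a) v) = monomial a 1 ⊗ₜ v)
    (y : L) :
    insertionOperator u φ 0 y = φ.conj (Algebra.lsmul K K (GenVerma 𝔭 V) (ι K y)) := by
  refine tensor_monomial_ext fun a v => ?_
  have hs : φ.symm (monomial a 1 ⊗ₜ v) = GenVerma.tmul 𝔭 (orderedMonomial u a) v := by
    rw [← hφ, LinearEquiv.symm_apply_apply]
  rw [insertionOperator_apply, insertMap_zero, LinearEquiv.conj_apply_apply, hs,
    LinearMap.comp_apply, LinearMap.comp_apply, LinearMap.rTensor_tmul, LinearMap.comp_apply,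
    polyToEnv_monomial]
  rfl

/-- The range is a subalgebra and U(L) is spanned by products of elements of L. -/
theorem conj_lsmul_mem_range
    (h : ∀ y : L, φ.conj (Algebra.lsmul K K (GenVerma 𝔭 V) (ι K y)) ∈
      (weylMatrixAction K (Fin n) V).range) (x : UniversalEnvelopingAlgebra K L) :
    φ.conj (Algebra.lsmul K K (GenVerma 𝔭 V) x) ∈ (weylMatrixAction K (Fin n) V).range := by
  obtain ⟨d, hd⟩ := exists_mem_envFiltration x
  suffices hle : envFiltration K L d ≤ (Subalgebra.toSubmodule
      (weylMatrixAction K (Fin n) V).range).comap (φ.conj.toLinearMap ∘ₗ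
        (Algebra.lsmul K K (GenVerma 𝔭 V)).toLinearMap) from hle hd
  refine Submodule.span_le.2 ?_
  rintro _ ⟨l, -, rfl⟩
  change φ.conj (Algebra.lsmul K K (GenVerma 𝔭 V) _) ∈ (weylMatrixAction K (Fin n) V).range
  induction l with
  | nil =>
    simp only [List.map_nil, List.prod_nil, map_one]
    convert one_mem (weylMatrixAction K (Fin n) V).range
    exact LinearEquiv.conj_id φ
  | cons y l ih =>
    rw [List.map_cons, List.prod_cons, map_mul, Module.End.mul_eq_comp, LinearEquiv.conj_comp]
    exact mul_mem (h y) ih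

variable [CharZero K]

lemma insertionOperator_eq_sum (j : Fin n) (y : L) (N : ℕ)
    (hN : ((-LieAlgebra.ad K L (u j)) ^ N) y = 0) :
    insertionOperator u φ j y = ∑ k ∈ Finset.range N,
      insertionOperator u φ (j + 1) (((-LieAlgebra.ad K L (u j)) ^ k) y) *
        (weylAction K (Fin n) (weylDividedD K j k)).rTensor V := by
  rw [insertionOperator_apply, insertMap_eq_sum u j (ι K y) N (by
    rw [mulRight_sub_mulLeft_pow_ι, hN, map_zero])]
  have h : ∀ s : Finset ℕ, ∀ f : ℕ → (MvPolynomial (Fin n) K →ₗ[K] UniversalEnvelopingAlgebra K L),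
      (∑ k ∈ s, f k).rTensor V = ∑ k ∈ s, (f k).rTensor V := fun s f =>
    map_sum (LinearMap.rTensorHom V) f s
  have h' : ∀ s : Finset ℕ, ∀ f : ℕ → (MvPolynomial (Fin n) K ⊗[K] V →ₗ[K]
      UniversalEnvelopingAlgebra K L ⊗[K] V),
      (φ.toLinearMap ∘ₗ GenVerma.mk 𝔭 V) ∘ₗ (∑ k ∈ s, f k) =
        ∑ k ∈ s, (φ.toLinearMap ∘ₗ GenVerma.mk 𝔭 V) ∘ₗ f k := fun s f =>
    map_sum (LinearMap.compRight K (φ.toLinearMap ∘ₗ GenVerma.mk 𝔭 V)) f s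
  rw [h, ← LinearMap.comp_assoc, h']
  refine Finset.sum_congr rfl fun k _ => ?_
  rw [mulRight_sub_mulLeft_pow_ι, LinearMap.rTensor_comp, insertionOperator_apply]
  rfl

/-- The action of `L` on an induced module is by differential operators, in coordinates given by
the monomials in a basis of a subalgebra of nilpotent elements which is graded by `deg`. -/
theorem conj_lsmul_ι_mem_range
    (hφ : ∀ (a : Fin n →₀ ℕ) (v : V),
      φ (GenVerma.tmul 𝔭 (orderedMonomial u a) v) = monomial a 1 ⊗ₜ v)
    (hnil : ∀ i, IsNilpotent (LieAlgebra.ad K L (u i)))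
    (deg : Fin n → ℕ) (hdeg : ∀ i j, ⁅u j, u i⁆ ∈ Submodule.span K (u '' {l | deg i < deg l}))
    (hspan : ∀ y : L, ∃ z : 𝔭, y - z ∈ Submodule.span K (Set.range u)) (y : L) :
    φ.conj (Algebra.lsmul K K (GenVerma 𝔭 V) (ι K y)) ∈
      (weylMatrixAction K (Fin n) V).range := by
  set D := Subalgebra.toSubmodule (weylMatrixAction K (Fin n) V).range with hD
  obtain ⟨N, hN⟩ : ∃ N, ∀ i y, ((-LieAlgebra.ad K L (u i)) ^ N) y = 0 := by
    choose N hN using hnil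
    refine ⟨∑ i, N i, fun i y => ?_⟩
    rw [neg_pow, pow_eq_zero_of_le (Finset.single_le_sum (fun _ _ => Nat.zero_le _)
      (Finset.mem_univ i)) (hN i), mul_zero, LinearMap.zero_apply]
  have hstep : ∀ (j : Fin n) (y : L) (k : ℕ),
      insertionOperator u φ (j + 1) (((-LieAlgebra.ad K L (u j)) ^ k) y) ∈ D →
      insertionOperator u φ (j + 1) (((-LieAlgebra.ad K L (u j)) ^ k) y) *
        (weylAction K (Fin n) (weylDividedD K j k)).rTensor V ∈ D := fun j y k h =>
    (weylMatrixAction K (Fin n) V).range.mul_mem h (rTensor_weylAction_mem_range _)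
  -- The k = 0 term is insertion of y itself one place further, with no derivative. If all other
  -- terms lie in D, membership can be moved in either direction.
  have hsub : ∀ (j : Fin n) (y : L), (∀ k, 0 < k →
      insertionOperator u φ (j + 1) (((-LieAlgebra.ad K L (u j)) ^ k) y) ∈ D) →
      (insertionOperator u φ j y ∈ D ↔ insertionOperator u φ (j + 1) y ∈ D) := by
    intro j y h
    have hs := insertionOperator_eq_sum (φ := φ) j y (N + 1) (by
      rw [pow_succ', Module.End.mul_apply, hN, map_zero])
    rw [Finset.sum_range_succ', weylDividedD_zero, map_one, pow_zero, Module.End.one_apply,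
      Module.End.one_eq_id, LinearMap.rTensor_id, ← Module.End.one_eq_id, mul_one] at hs
    rw [hs]
    have hsum := Submodule.sum_mem D (t := Finset.range N) fun k _ =>
      hstep j y (k + 1) (h _ (Nat.succ_pos k))
    refine ⟨fun hy => ?_, D.add_mem hsum⟩
    have := D.add_mem hy (D.smul_mem (-1) hsum)
    convert this using 1
    refine LinearMap.ext fun t => ?_
    simp only [LinearMap.add_apply, LinearMap.smul_apply, neg_smul, one_smul]
    abel
  -- Strong induction on `M - deg i`: the terms with k > 0 involve only basis vectors of larger
  -- degree, so membership spreads from position i to every position.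
  have hu : ∀ i, ∀ j ≤ n, insertionOperator u φ j (u i) ∈ D := by
    obtain ⟨M, hM⟩ : ∃ M, ∀ i, deg i ≤ M :=
      ⟨∑ i, deg i, fun i => Finset.single_le_sum (fun _ _ => Nat.zero_le _) (Finset.mem_univ i)⟩
    intro i
    induction hd : M - deg i using Nat.strong_induction_on generalizing i with
    | _ d ih =>
      have hW : ∀ w ∈ Submodule.span K (u '' {l | deg i < deg l}), ∀ j ≤ n,
          insertionOperator u φ j w ∈ D := by
        intro w hw j hj
        refine (Submodule.span_le (p := D.comap (insertionOperator u φ j))).2 ?_ hw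
        rintro _ ⟨l, hl, rfl⟩
        have hl' : deg i < deg l := hl
        have := hM l
        exact ih (M - deg l) (by omega) l rfl j hj
      have had : ∀ (j : Fin n) (k : ℕ), ((-LieAlgebra.ad K L (u j)) ^ (k + 1)) (u i) ∈
          Submodule.span K (u '' {l | deg i < deg l}) := by
        intro j k
        induction k with
        | zero =>
          rw [zero_add, pow_one, LinearMap.neg_apply, LieAlgebra.ad_apply]
          exact neg_mem (hdeg i j)
        | succ k ihk =>
          rw [pow_succ', Module.End.mul_apply]
          refine (Submodule.span_le (p := (Submodule.span K (u '' {l | deg i < deg l})).comap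
            (-LieAlgebra.ad K L (u j)))).2 ?_ ihk
          rintro _ ⟨l, hl, rfl⟩
          have hl' : deg i < deg l := hl
          rw [SetLike.mem_coe, Submodule.mem_comap, LinearMap.neg_apply, LieAlgebra.ad_apply]
          exact neg_mem (Submodule.span_mono (Set.image_mono fun l' h => hl'.trans h) (hdeg l j))
      have hiff : ∀ j : ℕ, j < n → (insertionOperator u φ j (u i) ∈ D ↔
          insertionOperator u φ (j + 1) (u i) ∈ D) := fun j hj =>
        hsub ⟨j, hj⟩ (u i) fun k hk => by
          obtain ⟨k, rfl⟩ := Nat.exists_eq_succ_of_ne_zero hk.ne'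
          exact hW _ (had ⟨j, hj⟩ k) _ hj
      have h0 : ∀ j ≤ n, (insertionOperator u φ 0 (u i) ∈ D ↔
          insertionOperator u φ j (u i) ∈ D) := by
        intro j
        induction j with
        | zero => intro _; rfl
        | succ j ihj => intro hj; exact (ihj (by omega)).trans (hiff j hj)
      intro j hj
      exact (h0 j hj).1 ((h0 i i.2.le).2 (insertionOperator_self_mem hφ i))
  have hlast : ∀ y, insertionOperator u φ n y ∈ D := by
    intro y
    obtain ⟨z, hz⟩ := hspan y
    have h1 : insertionOperator u φ n (y - z) ∈ D := by
      refine (Submodule.span_le (p := D.comap (insertionOperator u φ n))).2 ?_ hz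
      rintro _ ⟨i, rfl⟩
      exact hu i n le_rfl
    have := add_mem h1 (show _ ∈ D from insertionOperator_length_mem hφ z)
    rwa [← map_add, sub_add_cancel] at this
  -- From the right end, where all of L is settled, membership descends one position at a time to
  -- position 0.
  have hall : ∀ j ≤ n, ∀ y, insertionOperator u φ (n - j) y ∈ D := by
    intro j
    induction j with
    | zero => intro _; exact hlast
    | succ j ihj =>
      intro hj y
      have hlt : n - (j + 1) < n := by omega
      have hs := insertionOperator_eq_sum (u := u) (φ := φ) ⟨n - (j + 1), hlt⟩ y N (hN _ y)
      simp only at hs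
      rw [hs]
      refine Submodule.sum_mem _ fun k _ => hstep ⟨n - (j + 1), hlt⟩ y k ?_
      have : n - (j + 1) + 1 = n - j := by omega
      simp only [this]
      exact ihj (by omega) _
  have := hall n le_rfl y
  rwa [Nat.sub_self, insertionOperator_zero hφ] at this

end DifferentialOperators

end

noncomputable section

/-! ### Parabolic subalgebras -/

section ParabolicStructure

open LieAlgebra LieAlgebra.IsKilling

variable {𝔤 : Type*} [LieRing 𝔤] [LieAlgebra ℂ 𝔤] [FiniteDimensional ℂ 𝔤]
  {H : LieSubalgebra ℂ 𝔤} [H.IsCartanSubalgebra] {𝔭 : LieSubalgebra ℂ 𝔤}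

lemma mem_root_of_isNonZero {α : LieModule.Weight ℂ H 𝔤} (hα : α.IsNonZero) : α ∈ H.root := by
  simpa [LieSubalgebra.root] using hα

variable [LieAlgebra.IsSemisimple ℂ 𝔤]

lemma height_neg (Δ : (rootSystem H).Base) {α : LieModule.Weight ℂ H 𝔤} (h : α ∈ H.root)
    (h' : -α ∈ H.root) : Δ.height ⟨-α, h'⟩ = -Δ.height ⟨α, h⟩ := by
  -- Here -α is written as α + (-2) α.
  have := Δ.height_add_zsmul (i := ⟨α, h⟩) (j := ⟨α, h⟩) (k := ⟨-α, h'⟩) (z := -2) (by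
    simp only [rootSystem_root_apply, LieModule.Weight.toLinear_neg]; module)
  rw [this, smul_eq_mul]; ring

/-- The structure of a parabolic subalgebra with respect to a base of the root system. -/
lemma IsParabolicSubalgebra.exists_base (h : IsParabolicSubalgebra H 𝔭) :
    H ≤ 𝔭 ∧ ∃ Δ : (rootSystem H).Base, ∀ α (hα : α ∈ H.root), 0 < Δ.height ⟨α, hα⟩ →
      (rootSpace H α).toSubmodule ≤ 𝔭.toSubmodule := by
  obtain ⟨𝔟, ⟨Δ, hΔ⟩, hb⟩ := h
  rw [← LieSubalgebra.toSubmodule_le_toSubmodule] at hb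
  rw [hΔ] at hb
  refine ⟨?_, Δ, fun α hα hpos => ?_⟩
  · rw [← LieSubalgebra.toSubmodule_le_toSubmodule]
    exact le_sup_left.trans hb
  · exact ((le_iSup₂_of_le (f := fun (α : H.root) (_ : Δ.IsPos α) =>
      (rootSpace H (α : LieModule.Weight ℂ H 𝔤)).toSubmodule) ⟨α, hα⟩ hpos le_rfl).trans
        le_sup_right).trans hb

/-- A subspace which is stable under operators with simultaneous eigenvectors `u l` of distinct
weights contains the components of its elements. -/
lemma smul_mem_of_sum_mem {K M A ι : Type*} [Field K] [AddCommGroup M] [Module K M]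
    (P : Submodule K M) (T : A → M →ₗ[K] M) (hT : ∀ h, ∀ x ∈ P, T h x ∈ P) (u : ι → M)
    (χ : ι → A → K) (hu : ∀ h l, T h (u l) = χ l h • u l) (hχ : Function.Injective χ)
    (s : Finset ι) (c : ι → K) (hc : ∑ l ∈ s, c l • u l ∈ P) : ∀ l ∈ s, c l • u l ∈ P := by
  classical
  induction s using Finset.induction_on generalizing c with
  | empty => simp
  | insert a s ha ih =>
    have hs : ∀ l ∈ s, c l • u l ∈ P := by
      intro l hl
      have hne : χ l ≠ χ a := fun h => ha (hχ h ▸ hl)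
      obtain ⟨h, hh⟩ := Function.ne_iff.1 hne
      -- Applying T h - χ_a(h) removes the a-th term and rescales the l-th by a nonzero factor, so
      -- induction applies.
      have h1 := P.sub_mem (hT h _ hc) (P.smul_mem (χ a h) hc)
      have h2 : T h (∑ l ∈ insert a s, c l • u l) - χ a h • ∑ l ∈ insert a s, c l • u l =
          ∑ l ∈ s, ((χ l h - χ a h) * c l) • u l := by
        rw [map_sum, Finset.smul_sum, ← Finset.sum_sub_distrib, Finset.sum_insert ha, map_smul, hu,
          smul_comm, sub_self, zero_add]
        refine Finset.sum_congr rfl fun l _ => ?_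
        rw [map_smul, hu]
        module
      have h3 := P.smul_mem (χ l h - χ a h)⁻¹ (ih _ (h2 ▸ h1) l hl)
      rwa [smul_smul, inv_mul_cancel_left₀ (sub_ne_zero.2 hh)] at h3
    intro l hl
    rcases Finset.mem_insert.1 hl with rfl | hl
    · rw [Finset.sum_insert ha] at hc
      exact (P.add_mem_iff_left (P.sum_mem hs)).1 hc
    · exact hs l hl

lemma exists_basis_append {K L : Type*} [Field K] [AddCommGroup L] [Module K L]
    {𝔭 : Submodule K L} {n m : ℕ} {u : Fin n → L} (hu : LinearIndependent K u)
    (p : Module.Basis (Fin m) K 𝔭) (hd : Disjoint (Submodule.span K (Set.range u)) 𝔭)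
    (hs : ∀ y : L, ∃ z : 𝔭, y - z ∈ Submodule.span K (Set.range u)) :
    ∃ e : Module.Basis (Fin (n + m)) K L, ⇑e = Fin.append u fun j => (p j : L) := by
  have hr : Submodule.span K (Set.range fun j => (p j : L)) = 𝔭 := by
    have := congrArg (Submodule.map 𝔭.subtype) p.span_eq
    rw [Submodule.map_span, ← Set.range_comp, Submodule.map_top, Submodule.range_subtype] at this
    exact this
  have hli : LinearIndependent K (Sum.elim u fun j => (p j : L)) :=
    hu.sum_type (p.linearIndependent.map' 𝔭.subtype 𝔭.ker_subtype) (by rwa [← hr] at hd)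
  have hsp : ⊤ ≤ Submodule.span K (Set.range (Sum.elim u fun j => (p j : L))) := by
    rintro y -
    obtain ⟨z, hz⟩ := hs y
    rw [Set.Sum.elim_range, Submodule.span_union, hr, ← sub_add_cancel y (z : L)]
    exact add_mem (Submodule.mem_sup_left hz) (Submodule.mem_sup_right z.2)
  refine ⟨(Module.Basis.mk hli hsp).reindex finSumFinEquiv, ?_⟩
  ext i
  refine Fin.addCases (fun i => ?_) (fun i => ?_) i <;> simp

/-! ### Root vectors of the opposite nilradical -/

section RootVectors

variable {n : ℕ} (u : Module.Basis (Fin n) ℂ (oppositeNilradical H 𝔭))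
  {α : Fin n → LieModule.Weight ℂ H 𝔤}

lemma range_span_eq_oppositeNilradical :
    Submodule.span ℂ (Set.range fun i => (u i : 𝔤)) = (oppositeNilradical H 𝔭).toSubmodule := by
  have := congrArg (Submodule.map (oppositeNilradical H 𝔭).toSubmodule.subtype) u.span_eq
  rw [Submodule.map_span, ← Set.range_comp, Submodule.map_top, Submodule.range_subtype] at this
  exact this

lemma linearIndependent_coe_basis : LinearIndependent ℂ fun i => (u i : 𝔤) :=
  u.linearIndependent.map' (oppositeNilradical H 𝔭).toSubmodule.subtype
    (oppositeNilradical H 𝔭).toSubmodule.ker_subtype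

/-- Root spaces are one-dimensional, so two basis vectors of equal weight would be proportional. -/
lemma rootVector_weight_injective
    (hα : ∀ i, α i ∈ nilradicalRoots H 𝔭)
    (hu : ∀ i, (u i : 𝔤) ∈ rootSpace H (-α i : LieModule.Weight ℂ H 𝔤)) :
    Function.Injective fun i => -(α i : H → ℂ) := by
  intro i j hij
  by_contra hne
  have hα' : α i = α j := by
    ext h; simpa using congrFun hij h
  have h1 := finrank_rootSpace_eq_one (-α i) (hα i).1.neg
  have hj := hu j
  rw [← hα'] at hj
  obtain ⟨c, hc⟩ := (finrank_eq_one_iff_of_nonzero' (⟨u i, hu i⟩ : rootSpace H (-α i))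
    (fun h => (linearIndependent_coe_basis u).ne_zero i (congrArg Subtype.val h))).1 h1 ⟨u j, hj⟩
  have hc' : c • (u i : 𝔤) = u j := congrArg Subtype.val hc
  have := (linearIndependent_coe_basis u).notMem_span_image (s := {i}) (x := j)
    (by simpa using Ne.symm hne)
  rw [Set.image_singleton] at this
  exact this (Submodule.mem_span_singleton.2 ⟨c, hc'⟩)

lemma rootVector_notMem
    (hα : ∀ i, α i ∈ nilradicalRoots H 𝔭)
    (hu : ∀ i, (u i : 𝔤) ∈ rootSpace H (-α i : LieModule.Weight ℂ H 𝔤))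
    (i : Fin n) : (u i : 𝔤) ∉ 𝔭 := by
  intro hi
  refine (hα i).2.2 fun x hx => ?_
  have h1 := finrank_rootSpace_eq_one (-α i) (hα i).1.neg
  obtain ⟨c, hc⟩ := (finrank_eq_one_iff_of_nonzero' (⟨u i, hu i⟩ : rootSpace H (-α i))
    (fun h => (linearIndependent_coe_basis u).ne_zero i (congrArg Subtype.val h))).1 h1 ⟨x, hx⟩
  have hc' : c • (u i : 𝔤) = x := congrArg Subtype.val hc
  exact hc' ▸ 𝔭.smul_mem c hi

lemma lie_rootVector
    (hu : ∀ i, (u i : 𝔤) ∈ rootSpace H (-α i : LieModule.Weight ℂ H 𝔤)) (h : H) (i : Fin n) :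
    ⁅(h : 𝔤), (u i : 𝔤)⁆ = (-(α i : H → ℂ)) h • (u i : 𝔤) :=
  lie_eq_smul_of_mem_rootSpace (hu i) h

/-- As 𝔭 contains H, it is stable under ad H and contains every weight component of its elements;
but no u_i lies in 𝔭. -/
lemma disjoint_span_rootVectors
    (hα : ∀ i, α i ∈ nilradicalRoots H 𝔭)
    (hu : ∀ i, (u i : 𝔤) ∈ rootSpace H (-α i : LieModule.Weight ℂ H 𝔤))
    (hH : H ≤ 𝔭) :
    Disjoint (Submodule.span ℂ (Set.range fun i => (u i : 𝔤))) 𝔭.toSubmodule := by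
  rw [Submodule.disjoint_def]
  intro x hx hp
  obtain ⟨c, rfl⟩ := (Submodule.mem_span_range_iff_exists_fun ℂ).1 hx
  have hmem := smul_mem_of_sum_mem 𝔭.toSubmodule (fun h : H => (ad ℂ 𝔤 (h : 𝔤) : 𝔤 →ₗ[ℂ] 𝔤))
    (fun h x hx => 𝔭.lie_mem (hH h.2) hx) (fun i => (u i : 𝔤)) (fun i => -(α i : H → ℂ))
    (fun h i => lie_rootVector u hu h i) (rootVector_weight_injective u hα hu) Finset.univ c hp
  refine Finset.sum_eq_zero fun i hi => ?_
  by_contra hne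
  have hc : c i ≠ 0 := fun h => hne (by rw [h, zero_smul])
  have := 𝔭.smul_mem (c i)⁻¹ (hmem i hi)
  rw [smul_smul, inv_mul_cancel₀ hc, one_smul] at this
  exact rootVector_notMem u hα hu i this

/-- If a root space is not in 𝔭, its root is negative for the base; the opposite root space is then
in 𝔭, so the original one is among the generators of 𝔫₋. -/
lemma exists_sub_mem_span_rootVectors (h𝔭 : IsParabolicSubalgebra H 𝔭) (y : 𝔤) :
    ∃ z : 𝔭, y - z ∈ Submodule.span ℂ (Set.range fun i => (u i : 𝔤)) := by
  obtain ⟨hH, Δ, hΔ⟩ := h𝔭.exists_base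
  rw [range_span_eq_oppositeNilradical]
  suffices h : y ∈ (oppositeNilradical H 𝔭).toSubmodule ⊔ 𝔭.toSubmodule by
    obtain ⟨a, ha, b, hb, rfl⟩ := Submodule.mem_sup.1 h
    exact ⟨⟨b, hb⟩, by simpa using ha⟩
  have hy : y ∈ ⨆ χ : LieModule.Weight ℂ H 𝔤, (rootSpace H χ).toSubmodule := by
    rw [← LieSubmodule.iSup_toSubmodule, LieModule.iSup_genWeightSpace_eq_top' ℂ H 𝔤]
    trivial
  refine (iSup_le fun χ => ?_ : ⨆ χ : LieModule.Weight ℂ H 𝔤, (rootSpace H χ).toSubmodule ≤ _) hy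
  by_cases h0 : χ.IsZero
  · refine le_trans (fun x hx => ?_) le_sup_right
    apply hH
    have hx' : x ∈ rootSpace H (χ : H → ℂ) := hx
    rw [h0.eq] at hx'
    rw [← zeroRootSubalgebra_eq_of_is_cartan ℂ 𝔤 H]
    exact hx'
  by_cases hχ : (rootSpace H χ).toSubmodule ≤ 𝔭.toSubmodule
  · exact hχ.trans le_sup_right
  have hneg : (rootSpace H (-χ : LieModule.Weight ℂ H 𝔤)).toSubmodule ≤ 𝔭.toSubmodule := by
    refine hΔ (-χ) (mem_root_of_isNonZero (LieModule.Weight.IsNonZero.neg h0)) ?_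
    rw [height_neg Δ (mem_root_of_isNonZero h0)]
    have h1 := Δ.height_ne_zero ⟨χ, mem_root_of_isNonZero h0⟩
    have h2 : ¬ 0 < Δ.height ⟨χ, mem_root_of_isNonZero h0⟩ := fun h => hχ (hΔ χ _ h)
    omega
  refine le_trans (fun x hx => LieSubalgebra.subset_lieSpan ?_) le_sup_left
  refine Set.mem_biUnion (x := -χ) ⟨LieModule.Weight.IsNonZero.neg h0, hneg, ?_⟩ ?_
  · rwa [neg_neg]
  · rw [neg_neg]; exact hx

/-- The degree is root height: roots of 𝔫 have positive height, and height is additive, so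
bracketing strictly increases it. -/
lemma exists_degree
    (hα : ∀ i, α i ∈ nilradicalRoots H 𝔭)
    (hu : ∀ i, (u i : 𝔤) ∈ rootSpace H (-α i : LieModule.Weight ℂ H 𝔤))
    (h𝔭 : IsParabolicSubalgebra H 𝔭) : ∃ deg : Fin n → ℕ,
    ∀ i j, ⁅(u j : 𝔤), (u i : 𝔤)⁆ ∈
      Submodule.span ℂ ((fun i => (u i : 𝔤)) '' {l | deg i < deg l}) := by
  obtain ⟨hH, Δ, hΔ⟩ := h𝔭.exists_base
  have hr : ∀ i, α i ∈ H.root := fun i => mem_root_of_isNonZero (hα i).1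
  have hpos : ∀ i, 0 < Δ.height ⟨α i, hr i⟩ := by
    intro i
    by_contra hle
    have h1 := Δ.height_ne_zero ⟨α i, hr i⟩
    refine (hα i).2.2 (hΔ (-α i) (mem_root_of_isNonZero (hα i).1.neg) ?_)
    rw [height_neg Δ (hr i)]
    omega
  refine ⟨fun i => (Δ.height ⟨α i, hr i⟩).toNat, fun i j => ?_⟩
  have hmem : ⁅(u j : 𝔤), (u i : 𝔤)⁆ ∈ Submodule.span ℂ (Set.range fun i => (u i : 𝔤)) := by
    rw [range_span_eq_oppositeNilradical]
    exact (oppositeNilradical H 𝔭).lie_mem (u j).2 (u i).2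
  obtain ⟨c, hc⟩ := (Submodule.mem_span_range_iff_exists_fun ℂ).1 hmem
  have hw := lie_mem_genWeightSpace_of_mem_genWeightSpace (hu j) (hu i)
  rw [← hc]
  refine Submodule.sum_mem _ fun l _ => ?_
  by_cases hcl : c l = 0
  · rw [hcl, zero_smul]; exact zero_mem _
  refine Submodule.smul_mem _ _ (Submodule.subset_span ⟨l, ?_, rfl⟩)
  -- The bracket has weight -(α_j + α_i); by linear independence every u_l occurring in it with
  -- nonzero coefficient has this weight.
  have hsum : ∀ h : H, α l h = α j h + α i h := by
    intro h
    have h1 := lie_eq_smul_of_mem_rootSpace hw h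
    rw [← hc, LieSubalgebra.coe_bracket_of_module, lie_sum, Finset.smul_sum, ← sub_eq_zero,
      ← Finset.sum_sub_distrib] at h1
    have h2 := Fintype.linearIndependent_iff.1 (linearIndependent_coe_basis u)
      (fun l => c l * (-(α l : H → ℂ) h) - (-(α j : H → ℂ) h + -(α i : H → ℂ) h) * c l) (by
        rw [← h1]
        refine Finset.sum_congr rfl fun l _ => ?_
        rw [lie_smul, lie_rootVector u hu, sub_smul, smul_smul, smul_smul]
        simp) l
    have h3 : c l * (-(α l h) - (-(α j h) - α i h)) = 0 := by
      rw [← h2]; ring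
    have h4 := (mul_eq_zero.1 h3).resolve_left hcl
    linear_combination -h4
  have hht := Δ.height_add (i := ⟨α j, hr j⟩) (j := ⟨α i, hr i⟩) (k := ⟨α l, hr l⟩) (by
    ext h; simpa using hsum h)
  have := hpos i
  have := hpos j
  change (Δ.height ⟨α i, hr i⟩).toNat < (Δ.height ⟨α l, hr l⟩).toNat
  omega

end RootVectors

end ParabolicStructure

end

noncomputable section

/-! ### Assembly of the homomorphism and injectivity on simple algebras -/

section Main

open UniversalEnvelopingAlgebra

lemma orderedMonomial_single {R L : Type*} [CommRing R] [LieRing L] [LieAlgebra R L] {n : ℕ}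
    (u : Fin n → L) (i : Fin n) :
    (orderedMonomial u (Finsupp.single i 1) : UniversalEnvelopingAlgebra R L) = ι R (u i) := by
  have h : exponentList (Finsupp.single i 1) = [i] := List.perm_singleton.1 (by
    rw [List.perm_iff_count]
    intro j
    rw [count_exponentList, List.count_singleton, Finsupp.single_apply]
    simp)
  rw [orderedMonomial_eq_prod, h]
  simp

attribute [local instance 100] LieRing.ofAssociativeRing in
/-- A Lie algebra with trivial center embeds into its enveloping algebra. -/
lemma enveloping_ι_injective {R L : Type*} [CommRing R] [LieRing L] [LieAlgebra R L]
    (h : LieAlgebra.center R L = ⊥) :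
    Function.Injective (ι R : L → UniversalEnvelopingAlgebra R L) := by
  have hc : (UniversalEnvelopingAlgebra.lift R (LieAlgebra.ad R L)) ∘ ι R = LieAlgebra.ad R L :=
    ι_comp_lift R _
  have hi : Function.Injective (LieAlgebra.ad R L) := by
    rw [← LieHom.ker_eq_bot, LieAlgebra.ad_ker_eq_self_module_ker,
      LieAlgebra.self_module_ker_eq_center, h]
  exact Function.Injective.of_comp (hc ▸ hi)

lemma tmul_ne_zero_of_monomial {K V σ : Type*} [Field K] [AddCommGroup V] [Module K V]
    (a : σ →₀ ℕ) {v : V} (hv : v ≠ 0) :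
    (MvPolynomial.monomial a (1 : K)) ⊗ₜ[K] v ≠ 0 := by
  classical
  intro h
  have h1 := congrArg (fun t => TensorProduct.equivFinsuppOfBasisLeft
    (MvPolynomial.basisMonomials σ K) t a) h
  simp only [map_zero, Finsupp.zero_apply,
    TensorProduct.equivFinsuppOfBasisLeft_apply_tmul_apply] at h1
  rw [show MvPolynomial.monomial a (1 : K) = MvPolynomial.basisMonomials σ K a by simp,
    Module.Basis.repr_self, Finsupp.single_eq_same, one_smul] at h1
  exact hv h1

/-- An algebra homomorphism on the enveloping algebra of a simple Lie algebra which does not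
vanish on the Lie algebra is injective on it. -/
lemma comp_ι_injective_of_isSimple {R L A : Type*} [CommRing R] [LieRing L] [LieAlgebra R L]
    [Ring A] [Algebra R A] [LieAlgebra.IsSimple R L]
    (Φ : UniversalEnvelopingAlgebra R L →ₐ[R] A) {x : L} (hx : Φ (ι R x) ≠ 0) :
    Function.Injective fun x : L => Φ (ι R x) := by
  let I : LieIdeal R L :=
    { carrier := {x | Φ (ι R x) = 0}
      zero_mem' := by simp
      add_mem' := fun {a b} ha hb => by
        rw [Set.mem_ofPred_eq] at ha hb ⊢
        rw [map_add, map_add, ha, hb, add_zero]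
      smul_mem' := fun c a ha => by
        rw [Set.mem_ofPred_eq] at ha ⊢
        rw [map_smul, map_smul, ha, smul_zero]
      lie_mem := fun {y m} hm => by
        have hm' : Φ (ι R m) = 0 := hm
        change Φ (ι R ⁅y, m⁆) = 0
        rw [enveloping_ι_lie, map_sub, map_mul, map_mul, hm', mul_zero, zero_mul, sub_zero] }
  have hI : I = ⊥ := (LieAlgebra.IsSimple.eq_bot_or_eq_top I).resolve_right fun h =>
    hx (show x ∈ I from h ▸ LieSubmodule.mem_top x)
  intro a b hab
  have : a - b ∈ I := by
    change Φ (ι R (a - b)) = 0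
    rw [map_sub, map_sub, sub_eq_zero]
    exact hab
  rw [hI, LieSubmodule.mem_bot] at this
  exact sub_eq_zero.1 this

end Main

end

theorem proposition3p6
    {𝔤 : Type*} [LieRing 𝔤] [LieAlgebra ℂ 𝔤] [FiniteDimensional ℂ 𝔤]
    [LieAlgebra.IsSemisimple ℂ 𝔤]
    (H : LieSubalgebra ℂ 𝔤) [H.IsCartanSubalgebra]
    (𝔭 : LieSubalgebra ℂ 𝔤) (h𝔭 : IsParabolicSubalgebra H 𝔭)
    (n : ℕ) (hn : n = Module.finrank ℂ (parabolicNilradical H 𝔭))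
    -- a basis of the opposite nilradical by root vectors, in an arbitrary order
    (u : Module.Basis (Fin n) ℂ (oppositeNilradical H 𝔭))
    (hu : ∀ i, ∃ α ∈ nilradicalRoots H 𝔭,
      (u i : 𝔤) ∈ LieAlgebra.rootSpace H (-α : LieModule.Weight ℂ H 𝔤))
    -- an arbitrary `𝔭`-module
    (V : Type*) [AddCommGroup V] [Module ℂ V] [LieRingModule 𝔭 V] [LieModule ℂ 𝔭 V] :
    -- the identification of `M(𝔤, 𝔭)` with `S ⊗ V`
    ∃ φ : GenVerma 𝔭 V ≃ₗ[ℂ] MvPolynomial (Fin n) ℂ ⊗[ℂ] V,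
      (∀ (a : Fin n →₀ ℕ) (v : V),
        φ (GenVerma.tmul 𝔭 (orderedMonomial (fun i => (u i : 𝔤)) a) v) =
          MvPolynomial.monomial a (1 : ℂ) ⊗ₜ[ℂ] v) ∧
      -- an algebra homomorphism, hence a Lie algebra homomorphism for the commutator brackets
      ∃ Φ : UniversalEnvelopingAlgebra ℂ 𝔤 →ₐ[ℂ]
          WeylAlgebra ℂ (Fin n) ⊗[ℂ] Module.End ℂ V,
        (∀ X : UniversalEnvelopingAlgebra ℂ 𝔤,
          φ.conj (Algebra.lsmul ℂ ℂ (GenVerma 𝔭 V) X) =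
            weylMatrixAction ℂ (Fin n) V (Φ X)) ∧
        (LieAlgebra.IsSimple ℂ 𝔤 → 𝔭 ≠ ⊤ → Nontrivial V →
          Function.Injective fun x : 𝔤 => Φ (UniversalEnvelopingAlgebra.ι ℂ x)) := by
  choose α hα hu using hu
  obtain ⟨hH, -⟩ := h𝔭.exists_base
  have hspan := exists_sub_mem_span_rootVectors u h𝔭
  have hι : Function.Injective
      (UniversalEnvelopingAlgebra.ι ℂ : 𝔤 → UniversalEnvelopingAlgebra ℂ 𝔤) :=
    enveloping_ι_injective (LieAlgebra.center_eq_bot ℂ 𝔤)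
  obtain ⟨e, he⟩ := exists_basis_append (linearIndependent_coe_basis u)
    (Module.finBasis ℂ 𝔭.toSubmodule) (disjoint_span_rootVectors u hα hu hH) hspan
  obtain ⟨φ, hφ⟩ : ∃ φ : GenVerma 𝔭 V ≃ₗ[ℂ] MvPolynomial (Fin n) ℂ ⊗[ℂ] V,
      ∀ (a : Fin n →₀ ℕ) (v : V),
        φ (GenVerma.tmul 𝔭 (orderedMonomial (fun i => (u i : 𝔤)) a) v) =
          MvPolynomial.monomial a (1 : ℂ) ⊗ₜ[ℂ] v :=
    ⟨genVermaEquiv 𝔭 V (p := Module.finBasis ℂ 𝔭.toSubmodule) (e := e) hι he,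
      genVermaEquiv_tmul 𝔭 V (p := Module.finBasis ℂ 𝔭.toSubmodule) hι he⟩
  refine ⟨φ, hφ, ?_⟩
  obtain ⟨deg, hdeg⟩ := exists_degree u hα hu h𝔭
  have hnil : ∀ i, IsNilpotent (LieAlgebra.ad ℂ 𝔤 (u i : 𝔤)) := fun i =>
    LieAlgebra.isNilpotent_ad_of_mem_rootSpace H
      (fun h => (hα i).1.neg h) (hu i)
  have hrange := conj_lsmul_mem_range (conj_lsmul_ι_mem_range hφ hnil deg hdeg hspan)
  let ρ : UniversalEnvelopingAlgebra ℂ 𝔤 →ₐ[ℂ] Module.End ℂ (MvPolynomial (Fin n) ℂ ⊗[ℂ] V) :=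
    (φ.conjAlgEquiv ℂ).toAlgHom.comp (Algebra.lsmul ℂ ℂ (GenVerma 𝔭 V))
  let E := AlgEquiv.ofInjective (weylMatrixAction ℂ (Fin n) V)
    (weylMatrixAction_injective ℂ (Fin n) V)
  let Φ : UniversalEnvelopingAlgebra ℂ 𝔤 →ₐ[ℂ] WeylAlgebra ℂ (Fin n) ⊗[ℂ] Module.End ℂ V :=
    E.symm.toAlgHom.comp (ρ.codRestrict _ hrange)
  have hΦ : ∀ X, φ.conj (Algebra.lsmul ℂ ℂ (GenVerma 𝔭 V) X) =
      weylMatrixAction ℂ (Fin n) V (Φ X) := fun X =>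
    (congrArg Subtype.val (E.apply_symm_apply (ρ.codRestrict _ hrange X))).symm
  refine ⟨Φ, hΦ, fun hs hp hV => ?_⟩
  obtain ⟨v, hv⟩ := exists_ne (0 : V)
  -- With no root vectors, every y would already lie in 𝔭, contrary to 𝔭 ≠ 𝔤.
  have hn0 : ∃ i : Fin n, True := by
    by_contra! h
    have : IsEmpty (Fin n) := ⟨fun i => h i⟩
    refine hp (eq_top_iff.2 fun y _ => ?_)
    obtain ⟨z, hz⟩ := hspan y
    rw [Set.range_eq_empty, Submodule.span_empty, Submodule.mem_bot, sub_eq_zero] at hz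
    exact hz ▸ z.2
  obtain ⟨i, -⟩ := hn0
  refine comp_ι_injective_of_isSimple (R := ℂ)
    (A := WeylAlgebra ℂ (Fin n) ⊗[ℂ] Module.End ℂ V) Φ (x := (u i : 𝔤)) fun h0 => ?_
  have h1 := hΦ (UniversalEnvelopingAlgebra.ι ℂ (u i : 𝔤))
  rw [h0, map_zero] at h1
  -- If Φ(u_i) were zero, u_i would kill 1 ⊗ v, whose image under u_i has coordinates x_i ⊗ v ≠ 0.
  have h2 := LinearMap.congr_fun h1 (φ (GenVerma.tmul 𝔭 1 v))
  rw [LinearEquiv.conj_apply_apply, LinearEquiv.symm_apply_apply, LinearMap.zero_apply] at h2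
  refine tmul_ne_zero_of_monomial (K := ℂ) (Finsupp.single i 1) hv ?_
  rw [← h2, ← hφ, orderedMonomial_single]
  congr 1
  exact congrArg (fun t => GenVerma.tmul 𝔭 t v) (mul_one _).symm
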